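/- For $\eta\in(0,\pi/3)$ let $a=\frac{e^{-i\eta}}{2\cos\eta}$, $f_1(z)=az$, $f_2(z)=1-\bar a z$ for $z\in\mathbb C$, and let the dragon curve $K_\eta$ be the attractor of $\{f_1,f_2\}$, i.e. the unique nonempty compact set $K_\eta\subset\mathbb C$ with $K_\eta=f_1(K_\eta)\cup f_2(K_\eta)$. Put $c=\frac1{1-|a|^4}$, $b_0=a+c|a|^4$, and, for integers $j\ge 0$, $z_j=c\,a^{j+1}$ and $w_j=1-c|a|^2a^j$. For integers $k\ge4$ let $$\Phi_k(\eta)=(1-|a|^4)\sin((k-1)\eta)-|a|^3\sin((k-2)\eta)+|a|^k\sin\eta .$$ For each integer $k\ge4$ the function $\Phi_k$ has a unique zero in the open interval $(\pi/k,\pi/(k-1))$, denoted by $\eta_k$. Let $k\ge4$ be an integer and let $\eta\in[\eta_{k+1},\eta_k)$. Then the convex hull $\mathrm{co}(K_\eta)$ is a polygon whose vertices (extreme points), taken in clockwise order, are exactly the $2k+2$ distinct points $$b_0,\ z_0,\ z_1,\ \dots,\ z_k,\ w_1,\ \dots,\ w_k .$$ -/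

import Mathlib

namespace DragonCurve

open Complex ComplexConjugate

/-- The parameter `a = e^{-iη} / (2 cos η)`. -/
noncomputable def a (η : ℝ) : ℂ := Complex.exp (-(η : ℂ) * Complex.I) / (2 * Real.cos η : ℝ)

/-- The first map `z ↦ a z` of the iterated function system. -/
noncomputable def f₁ (η : ℝ) (z : ℂ) : ℂ := a η * z

/-- The second map `z ↦ 1 - ā z` of the iterated function system. -/
noncomputable def f₂ (η : ℝ) (z : ℂ) : ℂ := 1 - conj (a η) * z

/-- `K` is an attractor of the system `{f₁, f₂}`: a nonempty compact set with
`K = f₁(K) ∪ f₂(K)`. -/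
structure IsAttractor (η : ℝ) (K : Set ℂ) : Prop where
  nonempty : K.Nonempty
  isCompact : IsCompact K
  eq_union : K = f₁ η '' K ∪ f₂ η '' K

/-- The constant `c = 1 / (1 - |a|⁴)`. -/
noncomputable def c (η : ℝ) : ℝ := 1 / (1 - ‖a η‖ ^ 4)

/-- `z_k = c a^{k+1}`. -/
noncomputable def z (η : ℝ) (k : ℕ) : ℂ := (c η : ℂ) * a η ^ (k + 1)

/-- `w_k = 1 - c |a|² a^k`. -/
noncomputable def w (η : ℝ) (k : ℕ) : ℂ := 1 - (c η : ℂ) * (‖a η‖ : ℂ) ^ 2 * a η ^ k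

/-- `b₀ = a + c |a|⁴`. -/
noncomputable def b₀ (η : ℝ) : ℂ := a η + (c η : ℂ) * (‖a η‖ : ℂ) ^ 4

/-- `Φ_k(η) = (1 - |a|⁴) sin((k-1)η) - |a|³ sin((k-2)η) + |a|^k sin η`. -/
noncomputable def Phi (k : ℕ) (η : ℝ) : ℝ :=
  (1 - ‖a η‖ ^ 4) * Real.sin (((k : ℝ) - 1) * η)
    - ‖a η‖ ^ 3 * Real.sin (((k : ℝ) - 2) * η) + ‖a η‖ ^ k * Real.sin η

/-- `t` is a zero of `Φ_k` in the open interval `(π/k, π/(k-1))`. -/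
def IsPhiZero (k : ℕ) (t : ℝ) : Prop :=
  t ∈ Set.Ioo (Real.pi / (k : ℝ)) (Real.pi / ((k : ℝ) - 1)) ∧ Phi k t = 0

/-- The list `b₀, z₀, z₁, …, z_k, w₁, …, w_k`. -/
noncomputable def vertexList (η : ℝ) (k : ℕ) : List ℂ :=
  b₀ η :: ((List.range (k + 1)).map (z η) ++ (List.range k).map (fun j => w η (j + 1)))

/-- `p` lies strictly to the right of the directed line from `u` to `v`. -/
def StrictlyRightOf (u v p : ℂ) : Prop := (conj (v - u) * (p - u)).im < 0

/-- `P` is a (convex, nondegenerate) polygon whose vertices, each listed once and taken in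
clockwise order, are the entries of `L`. The clockwise order is expressed by `clockwise`: for every
entry of `L` and its cyclic successor, all other vertices lie strictly to the right of the
directed line through these two, i.e. the segment joining them is an edge of the polygon, traversed
with the polygon on its right. -/
structure IsPolygonWithClockwiseVertices (P : Set ℂ) (L : List ℂ) : Prop where
  three_le_length : 3 ≤ L.length
  nodup : L.Nodup
  eq_convexHull : P = convexHull ℝ {p | p ∈ L}
  extremePoints_eq : P.extremePoints ℝ = {p | p ∈ L}
  clockwise : ∀ (i : ℕ) (hi : i < L.length), ∀ p ∈ L,
    p ≠ L[i] → p ≠ L[(i + 1) % L.length]'(Nat.mod_lt _ (Nat.zero_lt_of_lt hi)) →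
      StrictlyRightOf L[i] (L[(i + 1) % L.length]'(Nat.mod_lt _ (Nat.zero_lt_of_lt hi))) p

end DragonCurve

/-! Let P be the polygon with the listed vertices, described as the intersection of the half-planes
to the right of its edges (`Inside`). The hull is P for two reasons. First, every vertex lies in K
(`Inclination.vertex_mem`): z₀ is fixed by f₂f₂f₁f₁, and the other vertices are images of it.
Second, f₁ and f₂ map P into itself (`f₁_inside`, `f₂_inside`), and a nonempty closed invariant set
contains the attractor.

Invariance needs one check per edge and map. Writing directions as e^{-it}, f₁ pulls a half-plane of
direction t back to direction t - η, and f₂ to t + η + π. If the pulled-back direction lies between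
the two edges at a vertex p, then p is extremal for it among the points of P, so it suffices that
the image of p is to the right of the original edge. Most of these images are vertices; the rest are
settled by trigonometric inequalities, some only needed on one side of kη = π.

All edge directions are explicit except those of the long edge from z_k to w₁, of direction -θ, and
its f₂-image from w_k to b₀. Testing w₁ - z_k against the directions (k-1)η and kη gives positive
multiples of Φ_k and Φ_{k+1}. So their signs amount to (k-1)η + θ < π ≤ kη + θ, which makes P convex
with these vertices and fixes the cones used for invariance (`Admissible.exists_inclination`).

That η in [η_{k+1}, η_k) gives these signs follows from the monotonicity of Φ_k/(|a|^k sin η) for k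
≥ 5 and from explicit polynomials in |a|² when k = 4 (`admissible_of_mem`). -/

namespace DragonCurve

open Complex ComplexConjugate

/-! ### Cross products and directions in the plane -/

/-- The cross product of two plane vectors. -/
noncomputable def cross (p q : ℂ) : ℝ := p.re * q.im - p.im * q.re

/-- The unit vector `e^{-it}`. -/
noncomputable def dir (t : ℝ) : ℂ := ⟨Real.cos t, -Real.sin t⟩

@[simp] lemma dir_re (t : ℝ) : (dir t).re = Real.cos t := rfl
@[simp] lemma dir_im (t : ℝ) : (dir t).im = -Real.sin t := rfl

lemma cross_eq_im (p q : ℂ) : cross p q = (conj p * q).im := by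
  simp [cross]; ring

lemma cross_dir_dir (s t : ℝ) : cross (dir s) (dir t) = Real.sin (s - t) := by
  rw [Real.sin_sub]; simp [cross]; ring

lemma cross_add_right (p q q' : ℂ) : cross p (q + q') = cross p q + cross p q' := by
  simp [cross]; ring

lemma cross_sub_right (p q q' : ℂ) : cross p (q - q') = cross p q - cross p q' := by
  simp [cross]; ring

lemma cross_real_mul_right (p q : ℂ) (ρ : ℝ) : cross p (ρ * q) = ρ * cross p q := by
  simp [cross]; ring

lemma cross_real_mul_left (p q : ℂ) (ρ : ℝ) : cross (ρ * p) q = ρ * cross p q := by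
  simp [cross]; ring

lemma cross_self (p : ℂ) : cross p p = 0 := by simp [cross]; ring

lemma dir_add_two_pi (t : ℝ) : dir (t + 2 * Real.pi) = dir t := by
  apply Complex.ext <;> simp

lemma dir_sub_two_pi (t : ℝ) : dir (t - 2 * Real.pi) = dir t := by
  apply Complex.ext <;> simp

/-- Coordinates of a vector with respect to two unit vectors. -/
lemma sin_smul_eq (φ ψ : ℝ) (y : ℂ) :
    Real.sin (φ - ψ) • y = cross (dir φ) y • dir ψ - cross (dir ψ) y • dir φ := by
  rw [Real.sin_sub]
  apply Complex.ext <;>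
    simp only [cross, Complex.smul_re, Complex.smul_im, Complex.sub_re, Complex.sub_im,
      dir_re, dir_im, smul_eq_mul] <;> ring

/-- Multiplying the second factor by `ρ e^{-iη}` turns the first one by `η`. -/
lemma cross_dir_mul (φ η ρ : ℝ) (y : ℂ) :
    cross (dir φ) (ρ * dir η * y) = ρ * cross (dir (φ - η)) y := by
  simp [cross, Real.cos_sub, Real.sin_sub]; ring

/-- The conjugate factor of f₂ turns the other way, and its minus sign accounts for the extra π. -/
lemma cross_dir_neg_mul (φ η ρ : ℝ) (y : ℂ) :
    cross (dir φ) (-(ρ * dir (-η) * y)) = ρ * cross (dir (φ + η + Real.pi)) y := by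
  simp [cross, Real.cos_add, Real.sin_add]; ring

/-- The half-plane to the right of a direction contains the intersection of the half-planes of two
directions enclosing it. -/
lemma cross_dir_nonpos_of_between {φ γ ψ : ℝ} {y : ℂ} (h₁ : φ ≤ γ) (h₂ : γ ≤ ψ) (h₃ : φ < ψ)
    (h₄ : ψ < φ + Real.pi) (hφ : cross (dir φ) y ≤ 0) (hψ : cross (dir ψ) y ≤ 0) :
    cross (dir γ) y ≤ 0 := by
  -- Up to a positive factor, e^{-iγ} is a nonnegative combination of e^{-iφ} and e^{-iψ}.
  have key : Real.sin (ψ - φ) * cross (dir γ) y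
      = Real.sin (ψ - γ) * cross (dir φ) y + Real.sin (γ - φ) * cross (dir ψ) y := by
    simp only [cross, dir_re, dir_im, Real.sin_sub]
    ring
  have s₁ : 0 < Real.sin (ψ - φ) := Real.sin_pos_of_pos_of_lt_pi (by linarith) (by linarith)
  have s₂ : 0 ≤ Real.sin (ψ - γ) := Real.sin_nonneg_of_nonneg_of_le_pi (by linarith) (by linarith)
  have s₃ : 0 ≤ Real.sin (γ - φ) := Real.sin_nonneg_of_nonneg_of_le_pi (by linarith) (by linarith)
  by_contra! h
  have := mul_pos s₁ h
  have := mul_nonpos_of_nonneg_of_nonpos s₂ hφ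
  have := mul_nonpos_of_nonneg_of_nonpos s₃ hψ
  linarith

/-! ### Convex polygons given by turning edges -/

/-- A closed polygon `v 0, …, v n = v 0` whose edges `ρ i e^{-i φ i}` turn clockwise, by less than
`π` at each vertex and by `2π` altogether. -/
structure ClockwisePolygon (n : ℕ) (v : ℕ → ℂ) (ρ φ : ℕ → ℝ) : Prop where
  three_le : 3 ≤ n
  closed : v n = v 0
  pos : ∀ i < n, 0 < ρ i
  edge : ∀ i < n, v (i + 1) - v i = ρ i * dir (φ i)
  gap_pos : ∀ i, i + 1 < n → φ i < φ (i + 1)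
  gap_lt : ∀ i, i + 1 < n → φ (i + 1) < φ i + Real.pi
  last_pos : φ (n - 1) < φ 0 + 2 * Real.pi
  last_lt : φ 0 + 2 * Real.pi < φ (n - 1) + Real.pi

namespace ClockwisePolygon

variable {n : ℕ} {v : ℕ → ℂ} {ρ φ : ℕ → ℝ}

lemma angle_lt (h : ClockwisePolygon n v ρ φ) {i j : ℕ} (hij : i < j) (hj : j < n) :
    φ i < φ j := by
  induction j, hij using Nat.le_induction with
  | base => exact h.gap_pos i hj
  | succ j _ ih => exact (ih (by omega)).trans (h.gap_pos j hj)

lemma angle_le (h : ClockwisePolygon n v ρ φ) {i j : ℕ} (hij : i ≤ j) (hj : j < n) :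
    φ i ≤ φ j := by
  rcases hij.eq_or_lt with rfl | hij
  · exact le_rfl
  · exact (h.angle_lt hij hj).le

lemma angle_lt_first (h : ClockwisePolygon n v ρ φ) {i : ℕ} (hi : i < n) :
    φ i < φ 0 + 2 * Real.pi :=
  (h.angle_le (Nat.le_sub_one_of_lt hi) (by omega)).trans_lt h.last_pos

lemma cross_diff (h : ClockwisePolygon n v ρ φ) (t : ℝ) {i j : ℕ} (hij : i ≤ j) (hj : j ≤ n) :
    cross (dir t) (v j - v i) = ∑ m ∈ Finset.Ico i j, ρ m * Real.sin (t - φ m) := by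
  induction j, hij using Nat.le_induction with
  | base => simp [cross]
  | succ j hij ih =>
    rw [Finset.sum_Ico_succ_top hij, ← ih (by omega), ← cross_dir_dir, ← cross_real_mul_right,
      ← h.edge j (by omega), ← cross_add_right]
    congr 1; ring

/-- Every vertex off an edge lies strictly to the right of that edge. -/
lemma cross_neg (h : ClockwisePolygon n v ρ φ) {i j : ℕ} (hi : i < n) (hj : j < n) (hji : j ≠ i)
    (hj1 : j ≠ (i + 1) % n) : cross (dir (φ i)) (v j - v i) < 0 := by
  have hn := h.three_le
  have neg : ∀ m < n, 0 < φ m - φ i → φ m - φ i < Real.pi →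
      ρ m * Real.sin (φ i - φ m) < 0 := fun m hm h0 h1 =>
    mul_neg_of_pos_of_neg (h.pos m hm)
      (Real.sin_neg_of_neg_of_neg_pi_lt (by linarith) (by linarith))
  have pos : ∀ m < n, 0 < φ i - φ m → φ i - φ m < Real.pi →
      0 < ρ m * Real.sin (φ i - φ m) := fun m hm h0 h1 =>
    mul_pos (h.pos m hm) (Real.sin_pos_of_pos_of_lt_pi h0 h1)
  have neg' : ∀ m < n, Real.pi < φ i - φ m → φ i - φ m < 2 * Real.pi →
      ρ m * Real.sin (φ i - φ m) < 0 := fun m hm h0 h1 => by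
    have : Real.sin (φ i - φ m) < 0 := by
      rw [← Real.sin_sub_two_pi]
      exact Real.sin_neg_of_neg_of_neg_pi_lt (by linarith) (by linarith)
    exact mul_neg_of_pos_of_neg (h.pos m hm) this
  have pos' : ∀ m < n, Real.pi < φ m - φ i → φ m - φ i < 2 * Real.pi →
      0 < ρ m * Real.sin (φ i - φ m) := fun m hm h0 h1 => by
    have : 0 < Real.sin (φ i - φ m) := by
      rw [← Real.sin_add_two_pi]
      exact Real.sin_pos_of_pos_of_lt_pi (by linarith) (by linarith)
    exact mul_pos (h.pos m hm) this
  -- Because the polygon closes up, one may also travel from q to p through vertex n = 0. Below, the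
  -- arc between i and j is chosen so that all its edges contribute with one sign.
  have total : ∀ {p q : ℕ}, p ≤ q → q < n →
      cross (dir (φ i)) (v p - v q) = ∑ m ∈ Finset.Ico q n, ρ m * Real.sin (φ i - φ m)
        + ∑ m ∈ Finset.Ico 0 p, ρ m * Real.sin (φ i - φ m) := fun {p q} hpq hq => by
    rw [← h.cross_diff _ hq.le le_rfl, ← h.cross_diff _ (Nat.zero_le p) (by omega),
      ← cross_add_right, h.closed]
    congr 1; ring
  rcases lt_or_gt_of_ne hji with hlt | hgt
  · by_cases hπ : φ i - φ j < Real.pi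
    · have hs : 0 < cross (dir (φ i)) (v i - v j) := by
        rw [h.cross_diff _ hlt.le hi.le]
        refine Finset.sum_pos (fun m hm => ?_) ⟨j, by simp [hlt]⟩
        rw [Finset.mem_Ico] at hm
        have := h.angle_lt hm.2 hi
        have := h.angle_le hm.1 (by omega)
        exact pos m (by omega) (by linarith) (by linarith)
      have : cross (dir (φ i)) (v j - v i) = -cross (dir (φ i)) (v i - v j) := by
        simp only [cross_sub_right]; ring
      linarith
    · push Not at hπ
      rw [total hlt.le hi, Finset.sum_eq_sum_Ico_succ_bot hi]
      have h0 : ρ i * Real.sin (φ i - φ i) = 0 := by simp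
      have hA : ∀ m ∈ Finset.Ico (i + 1) n, ρ m * Real.sin (φ i - φ m) < 0 := fun m hm => by
        rw [Finset.mem_Ico] at hm
        have h1 := h.angle_lt (show i < m by omega) hm.2
        have h2 := h.angle_lt_first hm.2
        have h3 := h.angle_le (Nat.zero_le j) hj
        exact neg m hm.2 (by linarith) (by linarith)
      have hB : ∀ m ∈ Finset.Ico 0 j, ρ m * Real.sin (φ i - φ m) < 0 := fun m hm => by
        rw [Finset.mem_Ico] at hm
        have h1 := h.angle_lt hm.2 hj
        have h2 := h.angle_lt_first hi
        have h3 := h.angle_le (Nat.zero_le m) (by omega)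
        exact neg' m (by omega) (by linarith) (by linarith)
      have hA' := Finset.sum_nonpos fun m hm => (hA m hm).le
      have hB' := Finset.sum_nonpos fun m hm => (hB m hm).le
      -- Edge i itself contributes zero, so strictness needs another edge on the arc: edge i + 1, or
      -- edge 0 when i is last, where j ≠ 0 is needed.
      by_cases hin : i + 1 < n
      · have := Finset.sum_neg hA ⟨i + 1, by simp [hin]⟩
        linarith
      · have hin' : i + 1 = n := by omega
        rw [hin', Nat.mod_self] at hj1
        have := Finset.sum_neg hB ⟨0, by simp; omega⟩
        linarith
  · have hin : i + 1 < n := by omega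
    rw [Nat.mod_eq_of_lt hin] at hj1
    by_cases hπ : φ (j - 1) - φ i ≤ Real.pi
    · rw [h.cross_diff _ hgt.le hj.le, Finset.sum_eq_sum_Ico_succ_bot hgt,
        Finset.sum_eq_sum_Ico_succ_bot (by omega)]
      have h0 : ρ i * Real.sin (φ i - φ i) = 0 := by simp
      have h1 := neg (i + 1) hin (by linarith [h.gap_pos i hin]) (by linarith [h.gap_lt i hin])
      have h2 : ∑ m ∈ Finset.Ico (i + 1 + 1) j, ρ m * Real.sin (φ i - φ m) ≤ 0 := by
        refine Finset.sum_nonpos fun m hm => ?_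
        rw [Finset.mem_Ico] at hm
        have h1 := h.angle_lt (show i < m by omega) (by omega)
        have h2 := h.angle_le (show m ≤ j - 1 by omega) (by omega)
        exact mul_nonpos_of_nonneg_of_nonpos (h.pos m (by omega)).le
          (Real.sin_nonpos_of_nonpos_of_neg_pi_le (by linarith) (by linarith))
      linarith
    · push Not at hπ
      have hs : 0 < cross (dir (φ i)) (v i - v j) := by
        rw [total hgt.le hj]
        refine add_pos_of_pos_of_nonneg (Finset.sum_pos (fun m hm => ?_) ⟨j, by simp [hj]⟩)
          (Finset.sum_nonneg fun m hm => ?_)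
        · rw [Finset.mem_Ico] at hm
          have h1 := h.angle_le (show j - 1 ≤ m by omega) hm.2
          have h2 := h.angle_lt_first hm.2
          have h3 := h.angle_le (Nat.zero_le i) hi
          exact pos' m hm.2 (by linarith) (by linarith)
        · rw [Finset.mem_Ico] at hm
          have h1 := h.angle_lt hm.2 hi
          have h2 := h.angle_lt_first (show j - 1 < n by omega)
          have h3 := h.angle_le (Nat.zero_le m) (by omega)
          exact (pos m (by omega) (by linarith) (by linarith)).le
      have : cross (dir (φ i)) (v j - v i) = -cross (dir (φ i)) (v i - v j) := by
        simp only [cross_sub_right]; ring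
      linarith

lemma succ_mod (h : ClockwisePolygon n v ρ φ) {i : ℕ} (hi : i < n) :
    v ((i + 1) % n) = v (i + 1) := by
  rcases (show i + 1 ≤ n from hi).eq_or_lt with h1 | h1
  · rw [h1, Nat.mod_self, h.closed]
  · rw [Nat.mod_eq_of_lt h1]

lemma succ_ne (h : ClockwisePolygon n v ρ φ) {i : ℕ} (hi : i < n) : v (i + 1) ≠ v i := by
  intro he
  have h1 := congrArg (cross (dir (φ i + Real.pi / 2))) (h.edge i hi)
  rw [he, sub_self, cross_real_mul_right, cross_dir_dir] at h1
  have := h.pos i hi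
  simp [cross] at h1
  linarith

lemma cross_succ (h : ClockwisePolygon n v ρ φ) {i : ℕ} (hi : i < n) :
    cross (dir (φ i)) (v (i + 1) - v i) = 0 := by
  rw [h.edge i hi, cross_real_mul_right, cross_self, mul_zero]

lemma cross_nonpos (h : ClockwisePolygon n v ρ φ) {i j : ℕ} (hi : i < n) (hj : j < n) :
    cross (dir (φ i)) (v j - v i) ≤ 0 := by
  by_cases hji : j = i
  · simp [hji, cross]
  by_cases hj1 : j = (i + 1) % n
  · rw [hj1, h.succ_mod hi, h.cross_succ hi]
  · exact (h.cross_neg hi hj hji hj1).le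

lemma injOn (h : ClockwisePolygon n v ρ φ) {i j : ℕ} (hi : i < n) (hj : j < n)
    (hv : v j = v i) : j = i := by
  by_contra hji
  by_cases hj1 : j = (i + 1) % n
  · exact h.succ_ne hi (by rw [← h.succ_mod hi, ← hj1, hv])
  · have := h.cross_neg hi hj hji hj1
    rw [hv] at this
    simp [cross] at this

/-- The direction of the edge preceding the vertex `i`. -/
lemma exists_prev (h : ClockwisePolygon n v ρ φ) {i : ℕ} (hi : i < n) :
    ∃ m < n, (m + 1) % n = i ∧ ∃ ψ, dir ψ = dir (φ m) ∧ ψ < φ i ∧ φ i < ψ + Real.pi := by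
  have hn := h.three_le
  rcases Nat.eq_zero_or_pos i with rfl | hpos
  · refine ⟨n - 1, by omega, ?_, φ (n - 1) - 2 * Real.pi, dir_sub_two_pi _, ?_, ?_⟩
    · rw [Nat.sub_add_cancel (by omega), Nat.mod_self]
    · linarith [h.last_pos]
    · linarith [h.last_lt]
  · obtain ⟨m, rfl⟩ : ∃ m, i = m + 1 := ⟨i - 1, by omega⟩
    exact ⟨m, by omega, Nat.mod_eq_of_lt hi, φ m, rfl, h.gap_pos m hi, h.gap_lt m hi⟩

/-- A point to the right of all edges lies in the convex hull of the vertices. -/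
lemma mem_convexHull (h : ClockwisePolygon n v ρ φ) {x : ℂ}
    (hx : ∀ i < n, cross (dir (φ i)) (x - v i) ≤ 0) : x ∈ convexHull ℝ (v '' Set.Iio n) := by
  have hn := h.three_le
  have hfin : (v '' Set.Iio n).Finite := (Set.finite_Iio n).image v
  by_contra hxP
  -- At a vertex maximising the separating functional f, f is nonnegative on the incoming edge and
  -- nonpositive on the outgoing one. Expanding x - v i in these two directions forces f x ≤ f (v
  -- i), a contradiction.
  obtain ⟨f, s, hs, hsx⟩ := geometric_hahn_banach_closed_point (convex_convexHull ℝ _)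
    (hfin.isCompact_convexHull ℝ).isClosed hxP
  obtain ⟨i, hi, hmax⟩ := (Finset.range n).exists_max_image (fun j => f (v j))
    ⟨0, by simp; omega⟩
  rw [Finset.mem_range] at hi
  have hfv : f (v i) < s := hs _ (subset_convexHull ℝ _ ⟨i, hi, rfl⟩)
  obtain ⟨m, hm, hmi, ψ, hψ, h1, h2⟩ := h.exists_prev hi
  have hvm : v (m + 1) = v i := by rw [← h.succ_mod hm, hmi]
  have hfm : 0 ≤ f (dir ψ) := by
    have h3 := hmax m (by simpa using hm)
    have h4 : f (v (m + 1) - v m) = ρ m * f (dir ψ) := by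
      rw [h.edge m hm, hψ, ← Complex.real_smul, map_smul, smul_eq_mul]
    rw [map_sub, hvm] at h4
    have := h.pos m hm
    by_contra! hc
    nlinarith
  have hfi : f (dir (φ i)) ≤ 0 := by
    have h3 := hmax ((i + 1) % n) (by simpa using Nat.mod_lt _ (by omega))
    rw [h.succ_mod hi] at h3
    have h4 : f (v (i + 1) - v i) = ρ i * f (dir (φ i)) := by
      rw [h.edge i hi, ← Complex.real_smul, map_smul, smul_eq_mul]
    rw [map_sub] at h4
    have := h.pos i hi
    by_contra! hc
    nlinarith
  set y := x - v i with hy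
  have hyi : cross (dir (φ i)) y ≤ 0 := hx i hi
  have hym : cross (dir ψ) y ≤ 0 := by
    have h3 := hx m hm
    have h4 := h.cross_succ hm
    rw [hvm] at h4
    have : x - v m = y + (v i - v m) := by rw [hy]; ring
    rw [this, cross_add_right, h4, add_zero, ← hψ] at h3
    exact h3
  have hS : 0 < Real.sin (φ i - ψ) := Real.sin_pos_of_pos_of_lt_pi (by linarith) (by linarith)
  have hyeq := sin_smul_eq (φ i) ψ y
  have h5 := congrArg f hyeq
  rw [map_sub, map_smul, map_smul, map_smul, smul_eq_mul, smul_eq_mul, smul_eq_mul] at h5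
  have h6 : f y = f x - f (v i) := by rw [hy, map_sub]
  have h7 : 0 < f y := by linarith
  nlinarith [mul_pos hS h7, mul_nonneg (neg_nonneg.2 hyi) hfm,
    mul_nonneg (neg_nonneg.2 hym) (neg_nonneg.2 hfi)]

/-- The functionals of the two edges at the vertex are nonpositive on the hull and vanish at the
vertex, hence vanish at both ends of any segment through it. The edges are not parallel, so the
segment is a point. -/
lemma mem_extremePoints (h : ClockwisePolygon n v ρ φ) {i : ℕ} (hi : i < n) :
    v i ∈ (convexHull ℝ (v '' Set.Iio n)).extremePoints ℝ := by
  obtain ⟨m, hm, hmi, ψ, hψ, h1, h2⟩ := h.exists_prev hi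
  have hvm : v (m + 1) = v i := by rw [← h.succ_mod hm, hmi]
  have hle : ∀ j < n, ∀ p ∈ convexHull ℝ (v '' Set.Iio n), cross (dir (φ j)) (p - v j) ≤ 0 := by
    intro j hj p hp
    refine convexHull_min (t := {p | cross (dir (φ j)) (p - v j) ≤ 0}) ?_ ?_ hp
    · rintro _ ⟨l, hl, rfl⟩
      exact h.cross_nonpos hj hl
    · intro p hp q hq s t hs ht hst
      simp only [Set.mem_ofPred_eq] at hp hq ⊢
      have : s • p + t • q - v j = (s : ℂ) * (p - v j) + (t : ℂ) * (q - v j) := by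
        have : (t : ℂ) = 1 - s := by rw [← Complex.ofReal_one, ← hst]; push_cast; ring
        simp only [Complex.real_smul, this]; ring
      rw [this, cross_add_right, cross_real_mul_right, cross_real_mul_right]
      nlinarith
  have hm' : ∀ p ∈ convexHull ℝ (v '' Set.Iio n), cross (dir ψ) (p - v i) ≤ 0 := by
    intro p hp
    have h3 := hle m hm p hp
    have h4 := h.cross_succ hm
    rw [hvm] at h4
    have : p - v m = (p - v i) + (v i - v m) := by ring
    rwa [this, cross_add_right, h4, add_zero, ← hψ] at h3
  refine ⟨subset_convexHull ℝ _ ⟨i, hi, rfl⟩, fun p hp q hq hpq => ?_⟩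
  obtain ⟨s, t, hs, ht, hst, hpqv⟩ := hpq
  have hv : (s : ℂ) * (p - v i) + (t : ℂ) * (q - v i) = 0 := by
    have h5 : (t : ℂ) = 1 - s := by rw [← Complex.ofReal_one, ← hst]; push_cast; ring
    rw [← hpqv]
    simp only [Complex.real_smul, h5]; ring
  have zero : ∀ χ : ℝ, cross (dir χ) (p - v i) ≤ 0 → cross (dir χ) (q - v i) ≤ 0 →
      cross (dir χ) (p - v i) = 0 := fun χ hp hq => by
    have h6 := congrArg (cross (dir χ)) hv
    rw [cross_add_right, cross_real_mul_right, cross_real_mul_right] at h6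
    have h7 : cross (dir χ) 0 = 0 := by simp [cross]
    rw [h7] at h6
    nlinarith
  have e1 := zero (φ i) (hle i hi p hp) (hle i hi q hq)
  have e2 := zero ψ (hm' p hp) (hm' q hq)
  have hS : 0 < Real.sin (φ i - ψ) := Real.sin_pos_of_pos_of_lt_pi (by linarith) (by linarith)
  have hyeq := sin_smul_eq (φ i) ψ (p - v i)
  rw [e1, e2, zero_smul, zero_smul, sub_zero, smul_eq_zero] at hyeq
  exact sub_eq_zero.1 (hyeq.resolve_left hS.ne')

theorem isPolygonWithClockwiseVertices (h : ClockwisePolygon n v ρ φ) {L : List ℂ}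
    (hL : L.length = n) (hLv : ∀ (i : ℕ) (hi : i < L.length), L[i] = v i) :
    IsPolygonWithClockwiseVertices (convexHull ℝ (v '' Set.Iio n)) L := by
  have hset : {p | p ∈ L} = v '' Set.Iio n := by
    ext p
    simp only [Set.mem_ofPred_eq, List.mem_iff_getElem, Set.mem_image, Set.mem_Iio]
    constructor
    · rintro ⟨i, hi, rfl⟩
      exact ⟨i, hL ▸ hi, (hLv i hi).symm⟩
    · rintro ⟨i, hi, rfl⟩
      exact ⟨i, hL.symm ▸ hi, hLv i _⟩
  refine ⟨hL ▸ h.three_le, ?_, by rw [hset], ?_, ?_⟩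
  · rw [List.nodup_iff_injective_getElem]
    rintro ⟨i, hi⟩ ⟨j, hj⟩ hij
    simp only [hLv] at hij
    exact Fin.ext (h.injOn (hL ▸ hj) (hL ▸ hi) hij)
  · rw [hset]
    refine Set.Subset.antisymm extremePoints_convexHull_subset ?_
    rintro _ ⟨i, hi, rfl⟩
    exact h.mem_extremePoints hi
  · intro i hi p hp hp1 hp2
    have hin : i < n := hL ▸ hi
    obtain ⟨j, hj, rfl⟩ := List.mem_iff_getElem.1 hp
    simp only [hLv, hL] at hp1 hp2 ⊢
    have hji : j ≠ i := fun e => hp1 (by rw [e])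
    have hj1 : j ≠ (i + 1) % n := fun e => hp2 (by rw [e])
    have := h.cross_neg hin (hL ▸ hj) hji hj1
    rw [StrictlyRightOf, ← cross_eq_im, h.succ_mod hin, h.edge i hin, cross_real_mul_left]
    exact mul_neg_of_pos_of_neg (h.pos i hin) this

end ClockwisePolygon

/-! ### Existence, uniqueness and minimality of the attractor -/

lemma dist_f₁ (η : ℝ) (x y : ℂ) : dist (f₁ η x) (f₁ η y) = ‖a η‖ * dist x y := by
  rw [dist_eq_norm, dist_eq_norm, f₁, f₁, ← mul_sub, norm_mul]

lemma dist_f₂ (η : ℝ) (x y : ℂ) : dist (f₂ η x) (f₂ η y) = ‖a η‖ * dist x y := by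
  rw [dist_eq_norm, dist_eq_norm, f₂, f₂,
    show 1 - conj (a η) * x - (1 - conj (a η) * y) = -(conj (a η) * (x - y)) by ring,
    norm_neg, norm_mul, RCLike.norm_conj]

lemma continuous_f₁ (η : ℝ) : Continuous (f₁ η) := by unfold f₁; fun_prop

lemma continuous_f₂ (η : ℝ) : Continuous (f₂ η) := by unfold f₂; fun_prop

lemma infDist_le_of_mapsTo {f : ℂ → ℂ} {q : ℝ} (hq : 0 ≤ q)
    (hf : ∀ x y, dist (f x) (f y) = q * dist x y) {C : Set ℂ} (hC : C.Nonempty)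
    (hfC : Set.MapsTo f C C) (y : ℂ) :
    Metric.infDist (f y) C ≤ q * Metric.infDist y C := by
  have hle : ∀ p ∈ C, Metric.infDist (f y) C ≤ q * dist y p := fun p hp =>
    (Metric.infDist_le_dist_of_mem (hfC hp)).trans_eq (hf y p)
  rcases hq.eq_or_lt with rfl | hq
  · obtain ⟨p, hp⟩ := hC
    simpa using hle p hp
  · rw [← div_le_iff₀' hq, Metric.le_infDist hC]
    intro p hp
    rw [div_le_iff₀' hq]
    exact hle p hp

lemma IsAttractor.f₁_mem {η : ℝ} {K : Set ℂ} (hK : IsAttractor η K) {x : ℂ} (hx : x ∈ K) :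
    f₁ η x ∈ K := by
  rw [hK.eq_union]; exact Or.inl ⟨x, hx, rfl⟩

lemma IsAttractor.f₂_mem {η : ℝ} {K : Set ℂ} (hK : IsAttractor η K) {x : ℂ} (hx : x ∈ K) :
    f₂ η x ∈ K := by
  rw [hK.eq_union]; exact Or.inr ⟨x, hx, rfl⟩

/-- The attractor is contained in every nonempty closed invariant set. -/
lemma IsAttractor.subset_of_mapsTo {η : ℝ} {K C : Set ℂ} (hK : IsAttractor η K) (ha : ‖a η‖ < 1)
    (hCn : C.Nonempty) (hC : IsClosed C) (h₁ : Set.MapsTo (f₁ η) C C)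
    (h₂ : Set.MapsTo (f₂ η) C C) : K ⊆ C := by
  -- The point of K farthest from C is the image of a point of K, so the maximal distance is at most
  -- ‖a‖ times itself, hence zero.
  obtain ⟨x, hx, hmax⟩ := hK.isCompact.exists_isMaxOn hK.nonempty
    (Metric.continuous_infDist_pt C).continuousOn
  have key : ∃ y ∈ K, Metric.infDist x C ≤ ‖a η‖ * Metric.infDist y C := by
    rw [hK.eq_union] at hx
    rcases hx with ⟨y, hy, rfl⟩ | ⟨y, hy, rfl⟩
    · exact ⟨y, hy, infDist_le_of_mapsTo (norm_nonneg _) (dist_f₁ η) hCn h₁ y⟩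
    · exact ⟨y, hy, infDist_le_of_mapsTo (norm_nonneg _) (dist_f₂ η) hCn h₂ y⟩
  obtain ⟨y, hy, hxy⟩ := key
  have hyx : Metric.infDist y C ≤ Metric.infDist x C := hmax hy
  have h0 : Metric.infDist x C ≤ 0 := by
    have := norm_nonneg (a η)
    by_contra! hpos
    nlinarith
  intro p hp
  have hpx : Metric.infDist p C ≤ Metric.infDist x C := hmax hp
  exact (hC.mem_iff_infDist_zero hCn).2 (le_antisymm (hpx.trans h0) Metric.infDist_nonneg)

lemma IsAttractor.eq {η : ℝ} {K K' : Set ℂ} (ha : ‖a η‖ < 1) (hK : IsAttractor η K)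
    (hK' : IsAttractor η K') : K = K' :=
  Set.Subset.antisymm
    (hK.subset_of_mapsTo ha hK'.nonempty hK'.isCompact.isClosed (fun _ => hK'.f₁_mem)
      fun _ => hK'.f₂_mem)
    (hK'.subset_of_mapsTo ha hK.nonempty hK.isCompact.isClosed (fun _ => hK.f₁_mem)
      fun _ => hK.f₂_mem)

/-- The orbit of `0` under the semigroup generated by `f₁` and `f₂`. -/
inductive Orbit (η : ℝ) : ℂ → Prop
  | zero : Orbit η 0
  | f₁ {x : ℂ} : Orbit η x → Orbit η (f₁ η x)
  | f₂ {x : ℂ} : Orbit η x → Orbit η (f₂ η x)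

lemma Orbit.norm_le {η : ℝ} (ha : ‖a η‖ < 1) {x : ℂ} (hx : Orbit η x) :
    ‖x‖ ≤ 1 / (1 - ‖a η‖) := by
  have h1 : 0 < 1 - ‖a η‖ := by linarith
  have h0 := norm_nonneg (a η)
  -- The bound M solves M = 1 + ‖a‖ M, so both maps preserve the ball of radius M.
  have hM : ‖a η‖ * (1 / (1 - ‖a η‖)) = 1 / (1 - ‖a η‖) - 1 := by field_simp; ring
  have hM0 : 0 ≤ 1 / (1 - ‖a η‖) := by positivity
  induction hx with
  | zero => simpa using h1.le
  | f₁ _ ih =>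
    rw [DragonCurve.f₁, norm_mul]
    nlinarith [mul_le_mul_of_nonneg_left ih h0]
  | f₂ _ ih =>
    rw [DragonCurve.f₂]
    refine (norm_sub_le _ _).trans ?_
    rw [norm_mul, RCLike.norm_conj, norm_one]
    nlinarith [mul_le_mul_of_nonneg_left ih h0]

/-- Since f₁ fixes 0, the orbit of 0 is exactly the union of its two images. It is bounded, so its
closure is compact and taking closures commutes with the two maps. -/
lemma exists_isAttractor {η : ℝ} (ha : ‖a η‖ < 1) : ∃ K, IsAttractor η K := by
  set S : Set ℂ := {x | Orbit η x} with hS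
  have hbd : Bornology.IsBounded S :=
    (isBounded_iff_forall_norm_le).2 ⟨_, fun x hx => Orbit.norm_le ha hx⟩
  have hcomp : IsCompact (closure S) := hbd.isCompact_closure
  have hSeq : S = f₁ η '' S ∪ f₂ η '' S := by
    refine Set.Subset.antisymm ?_ ?_
    · intro x hx
      cases hx with
      | zero => exact Or.inl ⟨0, Orbit.zero, by simp [f₁]⟩
      | f₁ h => exact Or.inl ⟨_, h, rfl⟩
      | f₂ h => exact Or.inr ⟨_, h, rfl⟩
    · rintro _ (⟨x, hx, rfl⟩ | ⟨x, hx, rfl⟩)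
      · exact Orbit.f₁ hx
      · exact Orbit.f₂ hx
  refine ⟨closure S, ⟨0, subset_closure Orbit.zero⟩, hcomp, ?_⟩
  rw [image_closure_of_isCompact hcomp (continuous_f₁ η).continuousOn,
    image_closure_of_isCompact hcomp (continuous_f₂ η).continuousOn, ← closure_union, ← hSeq]

/-- A fixed point of a similarity of ratio less than one preserving `K` belongs to `K`. -/
lemma mem_of_fixed {K : Set ℂ} (hK : IsCompact K) (hne : K.Nonempty) {g : ℂ → ℂ} {q : ℝ}
    (hq : q < 1) (hg : Set.MapsTo g K K) (hd : ∀ x y, dist (g x) (g y) = q * dist x y) {p : ℂ}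
    (hp : g p = p) : p ∈ K := by
  obtain ⟨x, hx, hmin⟩ := hK.exists_isMinOn hne (continuous_id.dist continuous_const).continuousOn
    (f := fun x => dist x p)
  have h1 : dist x p ≤ dist (g x) p := hmin (hg hx)
  have h2 : dist (g x) p = q * dist x p := by rw [← hd, hp]
  have h3 : dist x p ≤ 0 := by
    have := dist_nonneg (x := x) (y := p)
    by_contra! hpos
    nlinarith
  rwa [← dist_le_zero.1 h3]

/-! ### The modulus of a and sines of multiples of η -/

section Parameter

variable {η : ℝ}

lemma cos_pos_of_mem (h0 : 0 < η) (h1 : η ≤ Real.pi / 3) : 0 < Real.cos η :=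
  Real.cos_pos_of_mem_Ioo ⟨by linarith [Real.pi_pos], by linarith [Real.pi_pos]⟩

lemma norm_a (hc : 0 < Real.cos η) : ‖a η‖ = 1 / (2 * Real.cos η) := by
  have h : -(η : ℂ) * Complex.I = ((-η : ℝ) : ℂ) * Complex.I := by push_cast; ring
  rw [a, norm_div, h, Complex.norm_exp_ofReal_mul_I, Complex.norm_real, Real.norm_of_nonneg]
  positivity

lemma norm_a_pos (hc : 0 < Real.cos η) : 0 < ‖a η‖ := by
  rw [norm_a hc]; positivity

lemma two_mul_norm_a_mul_cos (hc : 0 < Real.cos η) : 2 * ‖a η‖ * Real.cos η = 1 := by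
  rw [norm_a hc]; field_simp

lemma norm_a_lt_one (h0 : 0 < η) (h1 : η < Real.pi / 3) : ‖a η‖ < 1 := by
  have hc := cos_pos_of_mem h0 h1.le
  have h2 : 1 / 2 < Real.cos η := by
    rw [← Real.cos_pi_div_three]
    exact Real.cos_lt_cos_of_nonneg_of_le_pi_div_two h0.le (by linarith [Real.pi_pos]) h1
  rw [norm_a hc, div_lt_one (by positivity)]
  linarith

lemma norm_a_sq_le (h0 : 0 < η) (h1 : η ≤ Real.pi / 4) : ‖a η‖ ^ 2 ≤ 1 / 2 := by
  have hc := cos_pos_of_mem h0 (by linarith [Real.pi_pos])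
  have h2 : Real.sqrt 2 / 2 ≤ Real.cos η := by
    rw [← Real.cos_pi_div_four]
    exact Real.cos_le_cos_of_nonneg_of_le_pi h0.le (by linarith [Real.pi_pos]) h1
  have h3 : (Real.sqrt 2) ^ 2 = 2 := Real.sq_sqrt (by norm_num)
  have h4 : 1 / 2 ≤ Real.cos η ^ 2 := by
    have : 0 ≤ Real.sqrt 2 := Real.sqrt_nonneg 2
    nlinarith
  rw [norm_a hc, div_pow, div_le_div_iff₀ (by positivity) (by norm_num)]
  nlinarith

lemma norm_a_lt_norm_a {t t' : ℝ} (h0 : 0 < t) (h : t < t') (h1 : t' ≤ Real.pi / 3) :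
    ‖a t‖ < ‖a t'‖ := by
  have hc := cos_pos_of_mem h0 (h.le.trans h1)
  have hc' := cos_pos_of_mem (h0.trans h) h1
  rw [norm_a hc, norm_a hc', div_lt_div_iff₀ (by positivity) (by positivity)]
  have := Real.cos_lt_cos_of_nonneg_of_le_pi_div_two h0.le (by linarith [Real.pi_pos]) h
  linarith

/-- As 2‖a‖ cos η = 1, this is the three-term recursion for sin(nη) with coefficients in ‖a‖. -/
lemma norm_a_mul_sin_add (hc : 0 < Real.cos η) (x : ℝ) :
    ‖a η‖ * (Real.sin (x + η) + Real.sin (x - η)) = Real.sin x := by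
  rw [Real.sin_add, Real.sin_sub]
  linear_combination Real.sin x * two_mul_norm_a_mul_cos hc

lemma a_eq_mul_dir (hc : 0 < Real.cos η) : a η = (‖a η‖ : ℂ) * dir η := by
  have h : -(η : ℂ) * Complex.I = ((-η : ℝ) : ℂ) * Complex.I := by push_cast; ring
  rw [norm_a hc, a, h]
  apply Complex.ext
  · rw [Complex.div_ofReal_re, Complex.exp_ofReal_mul_I_re,
      Complex.re_ofReal_mul]
    simp; ring
  · rw [Complex.div_ofReal_im, Complex.exp_ofReal_mul_I_im, Complex.im_ofReal_mul]
    simp; ring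

end Parameter

/-- Eliminating sin((k-2)η) by the recursion leaves terms of known sign near π/k: for η ≤ π/4 the
leading coefficient is positive, since ‖a‖² ≤ 1/2. -/
lemma Phi_eq {η : ℝ} (hc : 0 < Real.cos η) (k : ℕ) :
    Phi k η = (1 - ‖a η‖ ^ 2 - ‖a η‖ ^ 4) * Real.sin (((k : ℝ) - 1) * η)
      + ‖a η‖ ^ 3 * Real.sin (k * η) + ‖a η‖ ^ k * Real.sin η := by
  have h := norm_a_mul_sin_add hc (((k : ℝ) - 1) * η)
  rw [show ((k : ℝ) - 1) * η + η = k * η by ring,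
    show ((k : ℝ) - 1) * η - η = ((k : ℝ) - 2) * η by ring] at h
  rw [Phi]
  linear_combination (-‖a η‖ ^ 2) * h

section SmallMultiples

variable {η : ℝ}

/-- This and the next multiples make the case k = 4 polynomial in ‖a‖²; there η may exceed π/4 and
the general sign estimates are not available. -/
lemma norm_a_mul_sin_two (hc : 0 < Real.cos η) : ‖a η‖ * Real.sin (2 * η) = Real.sin η := by
  have h := norm_a_mul_sin_add hc η
  rwa [sub_self, Real.sin_zero, add_zero, ← two_mul] at h

lemma norm_a_mul_sin_three (hc : 0 < Real.cos η) :
    ‖a η‖ ^ 2 * Real.sin (3 * η) = (1 - ‖a η‖ ^ 2) * Real.sin η := by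
  have h := norm_a_mul_sin_add hc (2 * η)
  rw [show 2 * η + η = 3 * η by ring, show 2 * η - η = η by ring] at h
  linear_combination ‖a η‖ * h + norm_a_mul_sin_two hc

lemma norm_a_mul_sin_four (hc : 0 < Real.cos η) :
    ‖a η‖ ^ 3 * Real.sin (4 * η) = (1 - 2 * ‖a η‖ ^ 2) * Real.sin η := by
  have h := norm_a_mul_sin_add hc (3 * η)
  rw [show 3 * η + η = 4 * η by ring, show 3 * η - η = 2 * η by ring] at h
  linear_combination ‖a η‖ ^ 2 * h + norm_a_mul_sin_three hc
    - ‖a η‖ ^ 2 * norm_a_mul_sin_two hc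

lemma norm_a_mul_sin_five (hc : 0 < Real.cos η) :
    ‖a η‖ ^ 4 * Real.sin (5 * η) = (1 - 3 * ‖a η‖ ^ 2 + ‖a η‖ ^ 4) * Real.sin η := by
  have h := norm_a_mul_sin_add hc (4 * η)
  rw [show 4 * η + η = 5 * η by ring, show 4 * η - η = 3 * η by ring] at h
  linear_combination ‖a η‖ ^ 3 * h + norm_a_mul_sin_four hc
    - ‖a η‖ ^ 2 * norm_a_mul_sin_three hc

lemma norm_a_mul_sin_six (hc : 0 < Real.cos η) :
    ‖a η‖ ^ 5 * Real.sin (6 * η) = (1 - 4 * ‖a η‖ ^ 2 + 3 * ‖a η‖ ^ 4) * Real.sin η := by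
  have h := norm_a_mul_sin_add hc (5 * η)
  rw [show 5 * η + η = 6 * η by ring, show 5 * η - η = 4 * η by ring] at h
  linear_combination ‖a η‖ ^ 4 * h + norm_a_mul_sin_five hc
    - ‖a η‖ ^ 2 * norm_a_mul_sin_four hc

lemma norm_a_sq_mul_Phi_four (hc : 0 < Real.cos η) :
    ‖a η‖ ^ 2 * Phi 4 η = Real.sin η * (1 - ‖a η‖ ^ 2) * (1 - 2 * ‖a η‖ ^ 4) := by
  rw [Phi, show ((4 : ℕ) : ℝ) = 4 by norm_num, show ((4 : ℝ) - 1) * η = 3 * η by ring,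
    show ((4 : ℝ) - 2) * η = 2 * η by ring]
  linear_combination (1 - ‖a η‖ ^ 4) * norm_a_mul_sin_three hc
    - ‖a η‖ ^ 4 * norm_a_mul_sin_two hc

end SmallMultiples

/-! ### Monotonicity and zeros of Φ_k -/

section Monotonicity

variable {k : ℕ}

lemma hasDerivAt_cos_pow_mul_sin_div (m : ℕ) (q t : ℝ) (ht : Real.sin t ≠ 0) :
    HasDerivAt (fun t => Real.cos t ^ (m + 1) * Real.sin (q * t) / Real.sin t)
      (Real.cos t ^ m * (-(m + 1) * Real.sin t ^ 2 * Real.sin (q * t)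
        + q * Real.cos t * Real.sin t * Real.cos (q * t) - Real.cos t ^ 2 * Real.sin (q * t))
        / Real.sin t ^ 2) t := by
  have h1 := (Real.hasDerivAt_cos t).pow (m + 1)
  have h2 : HasDerivAt (fun t => Real.sin (q * t)) (Real.cos (q * t) * q) t := by
    simpa using ((hasDerivAt_id t).const_mul q).sin
  have h3 := (h1.mul h2).div (Real.hasDerivAt_sin t) ht
  refine h3.congr_deriv ?_
  simp only [Pi.mul_apply, Pi.pow_apply, Nat.add_sub_cancel]
  push_cast
  ring

lemma pi_div_sub_one_le (hk : 5 ≤ k) : Real.pi / ((k : ℝ) - 1) ≤ Real.pi / 4 := by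
  have hk' : (5 : ℝ) ≤ k := by exact_mod_cast hk
  exact div_le_div_of_nonneg_left Real.pi_pos.le (by norm_num) (by linarith)

lemma mul_mem_of_mem_Icc (hk : 4 ≤ k) {t : ℝ}
    (ht : t ∈ Set.Icc (Real.pi / (k : ℝ)) (Real.pi / ((k : ℝ) - 1))) :
    0 < t ∧ Real.pi ≤ k * t ∧ ((k : ℝ) - 1) * t ≤ Real.pi := by
  have hk' : (4 : ℝ) ≤ k := by exact_mod_cast hk
  have h1 := ht.1
  have h2 := ht.2
  rw [div_le_iff₀' (by linarith)] at h1
  rw [le_div_iff₀' (by linarith)] at h2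
  exact ⟨lt_of_lt_of_le (div_pos Real.pi_pos (by linarith)) ht.1, h1, h2⟩

lemma mul_mem_of_mem_Ioo (hk : 4 ≤ k) {t : ℝ}
    (ht : t ∈ Set.Ioo (Real.pi / (k : ℝ)) (Real.pi / ((k : ℝ) - 1))) :
    0 < t ∧ Real.pi < k * t ∧ ((k : ℝ) - 1) * t < Real.pi := by
  have hk' : (4 : ℝ) ≤ k := by exact_mod_cast hk
  have h1 := ht.1
  have h2 := ht.2
  rw [div_lt_iff₀' (by linarith)] at h1
  rw [lt_div_iff₀' (by linarith)] at h2
  exact ⟨lt_trans (div_pos Real.pi_pos (by linarith)) ht.1, h1, h2⟩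

lemma strictAntiOn_cos_pow_mul_sin_div (hk : 5 ≤ k) :
    StrictAntiOn (fun t => Real.cos t ^ (k - 3) * Real.sin (k * t) / Real.sin t)
      (Set.Icc (Real.pi / (k : ℝ)) (Real.pi / ((k : ℝ) - 1))) := by
  have hk' : (5 : ℝ) ≤ k := by exact_mod_cast hk
  have hπ := Real.pi_pos
  obtain ⟨m, rfl⟩ : ∃ m, k = m + 4 := ⟨k - 4, by omega⟩
  have hbound : ∀ t ∈ Set.Icc (Real.pi / ((m + 4 : ℕ) : ℝ)) (Real.pi / (((m + 4 : ℕ) : ℝ) - 1)),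
      0 < t ∧ t ≤ Real.pi / 4 := fun t ht =>
    ⟨(mul_mem_of_mem_Icc (by omega) ht).1, ht.2.trans (pi_div_sub_one_le hk)⟩
  have hsin : ∀ t ∈ Set.Icc (Real.pi / ((m + 4 : ℕ) : ℝ)) (Real.pi / (((m + 4 : ℕ) : ℝ) - 1)),
      0 < Real.sin t := fun t ht =>
    Real.sin_pos_of_pos_of_lt_pi (hbound t ht).1 (by linarith [(hbound t ht).2])
  simp only [show m + 4 - 3 = m + 1 by omega]
  refine strictAntiOn_of_deriv_neg (convex_Icc _ _) (fun t ht =>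
    (hasDerivAt_cos_pow_mul_sin_div m _ t (hsin t ht).ne').continuousAt.continuousWithinAt) ?_
  intro t ht
  rw [interior_Icc] at ht
  have htI := Set.Ioo_subset_Icc_self ht
  have hs := hsin t htI
  obtain ⟨ht0, ht4⟩ := hbound t htI
  obtain ⟨-, hl, hr⟩ := mul_mem_of_mem_Ioo (by omega) ht
  have hc := cos_pos_of_mem ht0 (by linarith)
  rw [(hasDerivAt_cos_pow_mul_sin_div m _ t hs.ne').deriv]
  refine div_neg_of_neg_of_pos (mul_neg_of_pos_of_neg (by positivity) ?_) (by positivity)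
  set q : ℝ := ((m + 4 : ℕ) : ℝ) with hq
  have hm : (m : ℝ) = q - 4 := by rw [hq]; push_cast; ring
  -- The shifted angle qt - π lies in (0, t), so its tangent is at most tan t, which is `p3`. With
  -- sin t ≤ cos t this decides the sign of the derivative.
  have e1 : Real.sin (q * t) = -Real.sin (q * t - Real.pi) := by rw [Real.sin_sub_pi]; ring
  have e2 : Real.cos (q * t) = -Real.cos (q * t - Real.pi) := by rw [Real.cos_sub_pi]; ring
  have p1 : 0 < Real.sin (q * t - Real.pi) :=
    Real.sin_pos_of_pos_of_lt_pi (by linarith) (by linarith)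
  have p2 : 0 < Real.cos (q * t - Real.pi) :=
    Real.cos_pos_of_mem_Ioo ⟨by linarith, by linarith⟩
  have p3 : 0 ≤ Real.sin (t - (q * t - Real.pi)) :=
    Real.sin_nonneg_of_nonneg_of_le_pi (by linarith) (by linarith)
  rw [Real.sin_sub] at p3
  have hsc : Real.sin t ≤ Real.cos t := by
    rw [← Real.sin_pi_div_two_sub]
    exact Real.sin_le_sin_of_le_of_le_pi_div_two (by linarith) (by linarith) (by linarith)
  rw [e1, e2, hm]
  set σ := Real.sin (q * t - Real.pi)
  set κ := Real.cos (q * t - Real.pi)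
  set s := Real.sin t
  set C := Real.cos t
  have hss : s ^ 2 ≤ C ^ 2 := by gcongr
  have key : C * ((q - 3) * s ^ 2 * σ - q * C * s * κ + C ^ 2 * σ) < 0 := by
    have h1 : ((q - 3) * s ^ 2 + C ^ 2) * (C * σ) ≤ ((q - 3) * s ^ 2 + C ^ 2) * (s * κ) := by
      have : 0 ≤ (q - 3) * s ^ 2 + C ^ 2 := by
        have : 0 ≤ q - 3 := by linarith
        positivity
      exact mul_le_mul_of_nonneg_left (by linarith) this
    have h2 : (q - 3) * s ^ 2 + C ^ 2 < q * C ^ 2 := by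
      have : 0 < C ^ 2 := by positivity
      nlinarith
    have h3 : ((q - 3) * s ^ 2 + C ^ 2) * (s * κ) < q * C ^ 2 * (s * κ) :=
      mul_lt_mul_of_pos_right h2 (by positivity)
    linarith
  have := neg_of_mul_neg_right key hc.le
  linarith

/-- `Φ_k(η) / (|a|^k sin η)` is strictly decreasing between `π/k` and `π/(k-1)`. -/
lemma Phi_div_strictAntiOn (hk : 5 ≤ k) :
    StrictAntiOn (fun t => Phi k t / (‖a t‖ ^ k * Real.sin t))
      (Set.Icc (Real.pi / (k : ℝ)) (Real.pi / ((k : ℝ) - 1))) := by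
  have hk' : (5 : ℝ) ≤ k := by exact_mod_cast hk
  have hπ := Real.pi_pos
  intro t ht t' ht' htt
  have hanti := strictAntiOn_cos_pow_mul_sin_div hk ht ht' htt
  obtain ⟨t0, tl, tr⟩ := mul_mem_of_mem_Icc (by omega) ht
  obtain ⟨t0', tl', tr'⟩ := mul_mem_of_mem_Icc (by omega) ht'
  have t4 := ht.2.trans (pi_div_sub_one_le hk)
  have t4' := ht'.2.trans (pi_div_sub_one_le hk)
  have hc := cos_pos_of_mem t0 (by linarith)
  have hc' := cos_pos_of_mem t0' (by linarith)
  have hs : 0 < Real.sin t := Real.sin_pos_of_pos_of_lt_pi t0 (by linarith)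
  have hs' : 0 < Real.sin t' := Real.sin_pos_of_pos_of_lt_pi t0' (by linarith)
  have hr := norm_a_pos hc
  have hr' := norm_a_pos hc'
  -- The first summand is a product of two nonnegative nonincreasing factors; in the second,
  -- ‖a‖^(3-k) = (2 cos s)^(k-3) produces the function already shown to decrease strictly.
  have form : ∀ s, 0 < Real.cos s → 0 < Real.sin s → Phi k s / (‖a s‖ ^ k * Real.sin s)
      = (1 - ‖a s‖ ^ 2 - ‖a s‖ ^ 4) / ‖a s‖ ^ k * (Real.sin (((k : ℝ) - 1) * s) / Real.sin s)
        + 2 ^ (k - 3) * (Real.cos s ^ (k - 3) * Real.sin (k * s) / Real.sin s) + 1 := by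
    intro s hc hs
    have hr := norm_a_pos hc
    have hpow : (2 * Real.cos s) ^ (k - 3) * ‖a s‖ ^ k = ‖a s‖ ^ 3 := by
      obtain ⟨m, rfl⟩ : ∃ m, k = m + 3 := ⟨k - 3, by omega⟩
      rw [Nat.add_sub_cancel, pow_add, ← mul_assoc, ← mul_pow,
        show 2 * Real.cos s * ‖a s‖ = 2 * ‖a s‖ * Real.cos s by ring,
        two_mul_norm_a_mul_cos hc, one_pow, one_mul]
    rw [Phi_eq hc]
    rw [mul_pow] at hpow
    field_simp
    linear_combination (-Real.sin (k * s)) * hpow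
  simp only
  rw [form t hc hs, form t' hc' hs']
  have hlt := norm_a_lt_norm_a t0 htt (by linarith)
  have hx := norm_a_sq_le t0 t4
  have hx' := norm_a_sq_le t0' t4'
  have h1 : (1 - ‖a t'‖ ^ 2 - ‖a t'‖ ^ 4) / ‖a t'‖ ^ k
      ≤ (1 - ‖a t‖ ^ 2 - ‖a t‖ ^ 4) / ‖a t‖ ^ k := by
    have : 0 ≤ 1 - ‖a t‖ ^ 2 - ‖a t‖ ^ 4 := by nlinarith [sq_nonneg (‖a t‖)]
    gcongr
  have h2 : Real.sin (((k : ℝ) - 1) * t') / Real.sin t' ≤ Real.sin (((k : ℝ) - 1) * t) / Real.sin t := by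
    have e1 : Real.sin (((k : ℝ) - 1) * t') ≤ Real.sin (((k : ℝ) - 1) * t) := by
      rw [← Real.sin_pi_sub, ← Real.sin_pi_sub (((k : ℝ) - 1) * t)]
      exact Real.sin_le_sin_of_le_of_le_pi_div_two (by linarith) (by linarith) (by nlinarith)
    have e2 : Real.sin t ≤ Real.sin t' :=
      Real.sin_le_sin_of_le_of_le_pi_div_two (by linarith) (by linarith) htt.le
    have e3 : 0 ≤ Real.sin (((k : ℝ) - 1) * t) :=
      Real.sin_nonneg_of_nonneg_of_le_pi (by nlinarith) tr
    gcongr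
  have h3 : 0 ≤ Real.sin (((k : ℝ) - 1) * t') / Real.sin t' :=
    div_nonneg (Real.sin_nonneg_of_nonneg_of_le_pi (by nlinarith) tr') hs'.le
  have h4 : 0 ≤ (1 - ‖a t‖ ^ 2 - ‖a t‖ ^ 4) / ‖a t‖ ^ k := by
    have : 0 ≤ 1 - ‖a t‖ ^ 2 - ‖a t‖ ^ 4 := by nlinarith [sq_nonneg (‖a t‖)]
    positivity
  have h5 := mul_le_mul h1 h2 h3 h4
  have h6 : (0 : ℝ) < 2 ^ (k - 3) := by positivity
  have h7 := mul_lt_mul_of_pos_left hanti h6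
  linarith

lemma Phi_lt_of_lt (hk : 5 ≤ k) {t t' : ℝ}
    (ht : t ∈ Set.Icc (Real.pi / (k : ℝ)) (Real.pi / ((k : ℝ) - 1)))
    (ht' : t' ∈ Set.Icc (Real.pi / (k : ℝ)) (Real.pi / ((k : ℝ) - 1))) (htt : t < t') :
    (Phi k t' = 0 → 0 < Phi k t) ∧ (Phi k t = 0 → Phi k t' < 0) := by
  have h := Phi_div_strictAntiOn hk ht ht' htt
  have hpos : ∀ s ∈ Set.Icc (Real.pi / (k : ℝ)) (Real.pi / ((k : ℝ) - 1)),
      0 < ‖a s‖ ^ k * Real.sin s := by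
    intro s hs
    have h0 := (mul_mem_of_mem_Icc (by omega) hs).1
    have h4 := hs.2.trans (pi_div_sub_one_le hk)
    have hπ := Real.pi_pos
    have := norm_a_pos (cos_pos_of_mem h0 (by linarith))
    have := Real.sin_pos_of_pos_of_lt_pi h0 (by linarith)
    positivity
  have p := hpos t ht
  have p' := hpos t' ht'
  simp only at h
  refine ⟨fun h0 => ?_, fun h0 => ?_⟩
  · rw [h0, zero_div] at h
    exact (div_pos_iff_of_pos_right p).1 h
  · rw [h0, zero_div] at h
    exact (div_lt_iff₀ p').1 h |>.trans_eq (zero_mul _)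

end Monotonicity

lemma isPhiZero_four_iff {t : ℝ} :
    IsPhiZero 4 t ↔ t ∈ Set.Ioo (Real.pi / 4) (Real.pi / 3) ∧ 2 * ‖a t‖ ^ 4 = 1 := by
  have e : (((4 : ℕ) : ℝ) - 1) = 3 := by norm_num
  rw [IsPhiZero, e, Nat.cast_ofNat]
  refine and_congr_right fun ht => ?_
  have hπ := Real.pi_pos
  have h0 : 0 < t := by linarith [ht.1]
  have hc := cos_pos_of_mem h0 ht.2.le
  have hs : 0 < Real.sin t := Real.sin_pos_of_pos_of_lt_pi h0 (by linarith [ht.2])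
  have hr := norm_a_pos hc
  have hr1 := norm_a_lt_one h0 ht.2
  have hf : 0 < Real.sin t * (1 - ‖a t‖ ^ 2) := mul_pos hs (by nlinarith)
  have h := norm_a_sq_mul_Phi_four hc
  constructor
  · intro h1
    rw [h1, mul_zero] at h
    have := (mul_eq_zero.1 h.symm).resolve_left hf.ne'
    linarith
  · intro h1
    rw [show 1 - 2 * ‖a t‖ ^ 4 = 0 by linarith, mul_zero] at h
    exact (mul_eq_zero.1 h).resolve_left (by positivity)

lemma existsUnique_isPhiZero_four : ∃! t : ℝ, IsPhiZero 4 t := by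
  have hπ := Real.pi_pos
  simp only [isPhiZero_four_iff]
  -- With ‖a‖ = 1/(2 cos t), the equation 2‖a‖⁴ = 1 reads 8 cos⁴ t = 1.
  have hcont : ContinuousOn (fun t : ℝ => 8 * Real.cos t ^ 4) (Set.Icc (Real.pi / 4) (Real.pi / 3)) :=
    by fun_prop
  obtain ⟨t, ht, hv⟩ := intermediate_value_Ioo' (by linarith) hcont
    (show (1 : ℝ) ∈ Set.Ioo (8 * Real.cos (Real.pi / 3) ^ 4) (8 * Real.cos (Real.pi / 4) ^ 4) by
      rw [Real.cos_pi_div_three, Real.cos_pi_div_four, div_pow (Real.sqrt 2),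
        show Real.sqrt 2 ^ 4 = (Real.sqrt 2 ^ 2) ^ 2 by ring, Real.sq_sqrt (by norm_num)]
      norm_num)
  have hval : 2 * ‖a t‖ ^ 4 = 1 := by
    have hc := cos_pos_of_mem (by linarith [ht.1] : 0 < t) ht.2.le
    rw [norm_a hc]
    field_simp
    linarith
  refine ⟨t, ⟨ht, hval⟩, fun t' ht' => ?_⟩
  have h1 := ht'.2
  rcases lt_trichotomy t' t with h | h | h
  · have := norm_a_lt_norm_a (by linarith [ht'.1.1]) h ht.2.le
    have : ‖a t'‖ ^ 4 < ‖a t‖ ^ 4 := by gcongr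
    linarith
  · exact h
  · have := norm_a_lt_norm_a (by linarith [ht.1]) h ht'.1.2.le
    have : ‖a t‖ ^ 4 < ‖a t'‖ ^ 4 := by gcongr
    linarith

lemma continuousOn_norm_a : ContinuousOn (fun t => ‖a t‖) {t | 0 < Real.cos t} := by
  have h : ContinuousOn (fun t => 1 / (2 * Real.cos t)) {t | 0 < Real.cos t} :=
    continuousOn_const.div (by fun_prop) fun t ht => by
      have : 0 < Real.cos t := ht
      positivity
  exact h.congr fun t ht => norm_a ht

lemma existsUnique_isPhiZero {k : ℕ} (hk : 4 ≤ k) : ∃! t : ℝ, IsPhiZero k t := by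
  rcases hk.eq_or_lt with rfl | hk
  · exact existsUnique_isPhiZero_four
  have hk' : (5 : ℝ) ≤ k := by exact_mod_cast hk
  have hπ := Real.pi_pos
  have hle : Real.pi / (k : ℝ) < Real.pi / ((k : ℝ) - 1) :=
    div_lt_div_of_pos_left hπ (by linarith) (by linarith)
  have hbound : ∀ t ∈ Set.Icc (Real.pi / (k : ℝ)) (Real.pi / ((k : ℝ) - 1)),
      0 < t ∧ t ≤ Real.pi / 4 := fun t ht =>
    ⟨(mul_mem_of_mem_Icc (by omega) ht).1, ht.2.trans (pi_div_sub_one_le hk)⟩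
  have hcont : ContinuousOn (Phi k) (Set.Icc (Real.pi / (k : ℝ)) (Real.pi / ((k : ℝ) - 1))) := by
    have hn : ContinuousOn (fun t => ‖a t‖) (Set.Icc (Real.pi / (k : ℝ)) (Real.pi / ((k : ℝ) - 1))) :=
      continuousOn_norm_a.mono fun t ht =>
        cos_pos_of_mem (hbound t ht).1 (by linarith [(hbound t ht).2])
    unfold Phi
    fun_prop
  -- At π/k the term with sin(kt) vanishes, and at π/(k-1) the one with sin((k-1)t), which leaves
  -- (‖a‖^k - ‖a‖³) sin t there.
  have hl : 0 < Phi k (Real.pi / k) := by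
    obtain ⟨h0, h4⟩ := hbound _ (Set.left_mem_Icc.2 hle.le)
    have hc := cos_pos_of_mem h0 (by linarith)
    have hs : 0 < Real.sin (Real.pi / k) := Real.sin_pos_of_pos_of_lt_pi h0 (by linarith)
    have hr := norm_a_pos hc
    have hx := norm_a_sq_le h0 h4
    have e1 : (k : ℝ) * (Real.pi / k) = Real.pi := by field_simp
    rw [Phi_eq hc, sub_mul (k : ℝ), e1, one_mul, Real.sin_pi, Real.sin_pi_sub]
    have : 0 < 1 - ‖a (Real.pi / k)‖ ^ 2 - ‖a (Real.pi / k)‖ ^ 4 := by nlinarith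
    positivity
  have hr : Phi k (Real.pi / ((k : ℝ) - 1)) < 0 := by
    obtain ⟨h0, h4⟩ := hbound _ (Set.right_mem_Icc.2 hle.le)
    set t := Real.pi / ((k : ℝ) - 1) with ht
    have hc := cos_pos_of_mem h0 (by linarith)
    have hs : 0 < Real.sin t := Real.sin_pos_of_pos_of_lt_pi h0 (by linarith)
    have hr := norm_a_pos hc
    have e1 : ((k : ℝ) - 1) * t = Real.pi := by
      rw [ht, mul_div_cancel₀]; linarith
    have e2 : (k : ℝ) * t = t + Real.pi := by linarith
    rw [Phi_eq hc, e1, e2, Real.sin_pi, Real.sin_add_pi]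
    have : ‖a t‖ ^ k < ‖a t‖ ^ 3 :=
      pow_lt_pow_right_of_lt_one₀ hr (norm_a_lt_one h0 (by linarith)) (by omega)
    nlinarith
  obtain ⟨t, ht, hv⟩ := intermediate_value_Ioo' hle.le hcont (show (0 : ℝ) ∈ Set.Ioo _ _ from ⟨hr, hl⟩)
  refine ⟨t, ⟨ht, hv⟩, fun t' ht' => ?_⟩
  have hI := Set.Ioo_subset_Icc_self ht
  have hI' := Set.Ioo_subset_Icc_self ht'.1
  rcases lt_trichotomy t' t with h | h | h
  · have := (Phi_lt_of_lt hk hI' hI h).1 hv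
    linarith [ht'.2]
  · exact h
  · have := (Phi_lt_of_lt hk hI hI' h).1 ht'.2
    linarith

/-! ### Admissible parameters and their inequalities -/

/-- The parameters for which the hull has `2k + 2` vertices. -/
structure Admissible (k : ℕ) (η : ℝ) : Prop where
  four_le : 4 ≤ k
  pos : 0 < η
  lt_third : η < Real.pi / 3
  lower : Real.pi < (k + 1) * η
  upper : (k - 1) * η < Real.pi
  four : k = 4 → 2 * ‖a η‖ ^ 4 < 1
  Phi_pos : 0 < Phi k η
  Phi_succ : Phi (k + 1) η ≤ 0

/-- The two zeros lie on opposite sides of π/k. For k ≥ 5, Φ_k is controlled by monotonicity above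
π/k and by the signs of its terms below it; for Φ_{k+1} the roles are exchanged. At k = 4 the
factorisation of Φ₄ and a polynomial for Φ₅ step in. -/
lemma admissible_of_mem {k : ℕ} (hk : 4 ≤ k) {ηk ηk1 η : ℝ} (h₁ : IsPhiZero k ηk)
    (h₂ : IsPhiZero (k + 1) ηk1) (h : η ∈ Set.Ico ηk1 ηk) : Admissible k η := by
  have hk' : (4 : ℝ) ≤ k := by exact_mod_cast hk
  have hπ := Real.pi_pos
  obtain ⟨hk0, hkl, hku⟩ := mul_mem_of_mem_Ioo hk h₁.1
  obtain ⟨hk10, hk1l, hk1u⟩ := mul_mem_of_mem_Ioo (by omega) h₂.1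
  push_cast at hk1l hk1u
  have h0 : 0 < η := hk10.trans_le h.1
  have hup : ((k : ℝ) - 1) * η < Real.pi := by nlinarith [h.2]
  have h3 : η < Real.pi / 3 := by nlinarith
  have hlow : Real.pi < ((k : ℝ) + 1) * η := by nlinarith [h.1]
  have hc := cos_pos_of_mem h0 h3.le
  have hs : 0 < Real.sin η := Real.sin_pos_of_pos_of_lt_pi h0 (by linarith)
  have hr := norm_a_pos hc
  have hr1 := norm_a_lt_one h0 h3
  have h4 : k = 4 → 2 * ‖a η‖ ^ 4 < 1 := by
    rintro rfl
    rw [isPhiZero_four_iff] at h₁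
    have := norm_a_lt_norm_a h0 h.2 h₁.1.2.le
    have : ‖a η‖ ^ 4 < ‖a ηk‖ ^ 4 := by gcongr
    linarith
  refine ⟨hk, h0, h3, hlow, hup, h4, ?_, ?_⟩
  · rcases hk.eq_or_lt with rfl | hk5
    · have h5 := norm_a_sq_mul_Phi_four hc
      have h6 : 0 < Real.sin η * (1 - ‖a η‖ ^ 2) * (1 - 2 * ‖a η‖ ^ 4) :=
        mul_pos (mul_pos hs (by nlinarith)) (by linarith [h4 rfl])
      rw [← h5] at h6
      exact pos_of_mul_pos_right h6 (by positivity)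
    · rcases le_or_gt (Real.pi / k) η with hle | hlt
      · have hmem : η ∈ Set.Icc (Real.pi / (k : ℝ)) (Real.pi / ((k : ℝ) - 1)) :=
          ⟨hle, h.2.le.trans h₁.1.2.le⟩
        exact (Phi_lt_of_lt hk5 hmem (Set.Ioo_subset_Icc_self h₁.1) h.2).1 h₁.2
      · rw [lt_div_iff₀' (by linarith)] at hlt
        have hk5' : (5 : ℝ) ≤ k := by exact_mod_cast hk5
        have hx := norm_a_sq_le h0 (by nlinarith)
        rw [Phi_eq hc]
        have p1 : 0 ≤ 1 - ‖a η‖ ^ 2 - ‖a η‖ ^ 4 := by nlinarith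
        have p2 : 0 ≤ Real.sin (((k : ℝ) - 1) * η) :=
          Real.sin_nonneg_of_nonneg_of_le_pi (by nlinarith) hup.le
        have p3 : 0 ≤ Real.sin (k * η) :=
          Real.sin_nonneg_of_nonneg_of_le_pi (by positivity) hlt.le
        positivity
  · rcases le_or_gt (Real.pi / k) η with hle | hlt
    · rw [div_le_iff₀' (by linarith)] at hle
      rcases hk.eq_or_lt with rfl | hk5
      · have e4 := norm_a_mul_sin_four hc
        have e5 := norm_a_mul_sin_five hc
        have h5 := h4 rfl
        have hx : 1 / 2 ≤ ‖a η‖ ^ 2 := by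
          have h7 : Real.cos η ≤ Real.sqrt 2 / 2 := by
            rw [← Real.cos_pi_div_four]
            push_cast at hle
            exact Real.cos_le_cos_of_nonneg_of_le_pi (by linarith) (by linarith) (by linarith)
          have h8 : (Real.sqrt 2) ^ 2 = 2 := Real.sq_sqrt (by norm_num)
          have h9 : Real.cos η ^ 2 ≤ 1 / 2 := by nlinarith
          rw [norm_a hc, div_pow, div_le_div_iff₀ (by norm_num) (by positivity)]
          nlinarith
        have e : ‖a η‖ ^ 3 * Phi 5 η = (1 - 2 * ‖a η‖ ^ 2 - 2 * (‖a η‖ ^ 2) ^ 2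
            + 3 * (‖a η‖ ^ 2) ^ 3 + (‖a η‖ ^ 2) ^ 4) * Real.sin η := by
          rw [Phi_eq hc, show (((5 : ℕ) : ℝ) - 1) * η = 4 * η by push_cast; ring,
            show ((5 : ℕ) : ℝ) * η = 5 * η by push_cast; ring]
          linear_combination (1 - ‖a η‖ ^ 2 - ‖a η‖ ^ 4) * e4 + ‖a η‖ ^ 2 * e5
        -- Here x = ‖a‖² satisfies x ≥ 1/2, because η ≥ π/4, and 2x² < 1, because η lies below the
        -- zero of Φ₄.
        have hneg : 1 - 2 * ‖a η‖ ^ 2 - 2 * (‖a η‖ ^ 2) ^ 2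
            + 3 * (‖a η‖ ^ 2) ^ 3 + (‖a η‖ ^ 2) ^ 4 ≤ 0 := by
          have h10 : 2 * (‖a η‖ ^ 2) ^ 2 < 1 := by linarith
          set x := ‖a η‖ ^ 2
          have hx1 : x ≤ 3 / 4 := by nlinarith
          nlinarith [mul_nonneg (sub_nonneg.2 hx) (sub_nonneg.2 h10.le)]
        have h11 : ‖a η‖ ^ 3 * Phi 5 η ≤ 0 := by
          rw [e]; exact mul_nonpos_of_nonpos_of_nonneg hneg hs.le
        by_contra! hcon
        have := mul_pos (pow_pos hr 3) hcon
        linarith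
      · have hk5' : (5 : ℝ) ≤ k := by exact_mod_cast hk5
        have hη4 : η ≤ Real.pi / 4 := by nlinarith
        have hx := norm_a_sq_le h0 hη4
        have e1 : ((k + 1 : ℕ) : ℝ) - 1 = k := by push_cast; ring
        rw [Phi_eq hc, e1]
        have p1 : 0 ≤ 1 - ‖a η‖ ^ 2 - ‖a η‖ ^ 4 := by nlinarith
        have p2 : Real.sin (k * η) ≤ 0 := by
          have : 0 ≤ Real.sin (k * η - Real.pi) :=
            Real.sin_nonneg_of_nonneg_of_le_pi (by linarith) (by linarith)
          rw [Real.sin_sub_pi] at this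
          linarith
        have p3 : Real.sin ((k + 1 : ℕ) * η) ≤ -Real.sin η := by
          have e2 : ((k + 1 : ℕ) : ℝ) * η = (k * η - Real.pi) + η + Real.pi := by push_cast; ring
          rw [e2, Real.sin_add_pi, neg_le_neg_iff]
          exact Real.sin_le_sin_of_le_of_le_pi_div_two (by linarith) (by linarith) (by linarith)
        have p4 : ‖a η‖ ^ (k + 1) ≤ ‖a η‖ ^ 3 := pow_le_pow_of_le_one hr.le hr1.le (by omega)
        have p5 : 0 < ‖a η‖ ^ 3 := by positivity
        nlinarith [mul_nonneg p1 (neg_nonneg.2 p2), mul_le_mul_of_nonneg_left p3 p5.le,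
          mul_le_mul_of_nonneg_right p4 hs.le]
    · rcases h.1.eq_or_lt with rfl | hlt'
      · exact h₂.2.le
      · refine ((Phi_lt_of_lt (by omega) (Set.Ioo_subset_Icc_self h₂.1) ?_ hlt').2 h₂.2).le
        refine ⟨h₂.1.1.le.trans h.1, ?_⟩
        push_cast
        rw [add_sub_cancel_right]
        exact hlt.le

namespace Admissible

variable {k : ℕ} {η : ℝ}

lemma cos_pos (h : Admissible k η) : 0 < Real.cos η := cos_pos_of_mem h.pos h.lt_third.le

lemma sin_pos (h : Admissible k η) : 0 < Real.sin η :=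
  Real.sin_pos_of_pos_of_lt_pi h.pos (by linarith [h.lt_third, Real.pi_pos])

lemma norm_pos (h : Admissible k η) : 0 < ‖a η‖ := norm_a_pos h.cos_pos

lemma norm_lt_one (h : Admissible k η) : ‖a η‖ < 1 := norm_a_lt_one h.pos h.lt_third

lemma four_le_real (h : Admissible k η) : (4 : ℝ) ≤ k := by exact_mod_cast h.four_le

lemma eq_four_or (h : Admissible k η) : k = 4 ∨ η ≤ Real.pi / 4 := by
  rcases h.four_le.eq_or_lt with h4 | h5
  · exact Or.inl h4.symm
  · have hk5' : (5 : ℝ) ≤ k := by exact_mod_cast h5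
    exact Or.inr (by nlinarith [h.upper, h.pos])

lemma le_quarter (h : Admissible k η) (hkη : k * η ≤ Real.pi) : η ≤ Real.pi / 4 := by
  nlinarith [h.four_le_real, h.pos]

lemma coeff_nonneg (h : Admissible k η) (h4 : η ≤ Real.pi / 4) :
    0 ≤ 1 - ‖a η‖ ^ 2 - ‖a η‖ ^ 4 := by
  nlinarith [norm_a_sq_le h.pos h4, sq_nonneg ‖a η‖]

lemma sin_nonneg (h : Admissible k η) {x : ℝ} (h0 : 0 ≤ x) (h1 : x ≤ k - 1) :
    0 ≤ Real.sin (x * η) :=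
  Real.sin_nonneg_of_nonneg_of_le_pi (mul_nonneg h0 h.pos.le)
    ((mul_le_mul_of_nonneg_right h1 h.pos.le).trans h.upper.le)

/-- Up to a positive factor this is the imaginary part of w₁ - z_k; it gives θ > 0. -/
lemma sin_succ_bound (h : Admissible k η) :
    0 < ‖a η‖ ^ 2 * Real.sin η + ‖a η‖ ^ k * Real.sin ((k + 1) * η) := by
  have hs := h.sin_pos
  have hr := h.norm_pos
  have hr1 := h.norm_lt_one
  have hc := h.cos_pos
  have hk := h.four_le
  by_cases hk4 : k = 4
  · subst hk4
    have e5 := norm_a_mul_sin_five hc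
    rw [show (((4 : ℕ) : ℝ) + 1) * η = 5 * η by push_cast; ring, e5]
    have : 0 < (1 - ‖a η‖ ^ 2) ^ 2 := by
      have : 0 < 1 - ‖a η‖ ^ 2 := by nlinarith
      positivity
    nlinarith [mul_pos this hs]
  · have h4 := h.eq_four_or.resolve_left hk4
    have e2 := norm_a_mul_sin_two hc
    have e1 : Real.sin ((k + 1) * η) = -Real.sin ((k + 1) * η - Real.pi) := by
      rw [Real.sin_sub_pi]; ring
    have p1 : Real.sin ((k + 1) * η - Real.pi) ≤ Real.sin (2 * η) :=
      Real.sin_le_sin_of_le_of_le_pi_div_two (by linarith [h.lower, Real.pi_pos]) (by linarith)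
        (by linarith [h.upper])
    obtain ⟨m, rfl⟩ : ∃ m, k = m + 1 := ⟨k - 1, by omega⟩
    have p2 : ‖a η‖ ^ m < ‖a η‖ ^ 2 := pow_lt_pow_right_of_lt_one₀ hr hr1 (by omega)
    have p3 : 0 < ‖a η‖ ^ (m + 1) := by positivity
    have p4 := mul_le_mul_of_nonneg_left p1 p3.le
    have p5 : ‖a η‖ ^ (m + 1) * Real.sin (2 * η) = ‖a η‖ ^ m * Real.sin η := by
      rw [pow_succ, mul_assoc, e2]
    have p6 := mul_lt_mul_of_pos_right p2 hs
    rw [e1]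
    linarith

/-- This gives θ ≤ η, through the cross product of w₁ - z_k with the direction -η. -/
lemma sin_add_two_bound (h : Admissible k η) :
    0 ≤ (1 - ‖a η‖ ^ 2 - ‖a η‖ ^ 4) * Real.sin η
      - ‖a η‖ ^ (k + 1) * Real.sin ((k + 2) * η) := by
  have hs := h.sin_pos
  have hr := h.norm_pos
  have hc := h.cos_pos
  by_cases hk4 : k = 4
  · have hx := h.four hk4
    subst hk4
    have e6 := norm_a_mul_sin_six hc
    rw [show (((4 : ℕ) : ℝ) + 2) * η = 6 * η by push_cast; ring, e6]
    have : 0 ≤ 3 * ‖a η‖ ^ 2 - 4 * ‖a η‖ ^ 4 := by nlinarith [sq_nonneg (‖a η‖ ^ 2)]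
    nlinarith [mul_nonneg this hs.le]
  · have h4 := h.eq_four_or.resolve_left hk4
    have p1 : 0 ≤ Real.sin ((k + 2) * η - Real.pi) :=
      Real.sin_nonneg_of_nonneg_of_le_pi (by linarith [h.lower, h.pos])
        (by linarith [h.upper, h.lt_third])
    rw [Real.sin_sub_pi] at p1
    have p2 := mul_nonneg (pow_pos hr (k + 1)).le p1
    have p3 := mul_nonneg (h.coeff_nonneg h4) hs.le
    linarith

lemma neg_sin_add_two_le (h : Admissible k η) (hkη : k * η ≤ Real.pi) :
    ‖a η‖ ^ (k + 1) * -Real.sin ((k + 2) * η) ≤ ‖a η‖ ^ 2 * Real.sin η := by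
  have hs := h.sin_pos
  have hr := h.norm_pos
  have h4 := h.le_quarter hkη
  have e2 := norm_a_mul_sin_two h.cos_pos
  have p1 : Real.sin ((k + 2) * η - Real.pi) ≤ Real.sin (2 * η) :=
    Real.sin_le_sin_of_le_of_le_pi_div_two (by linarith [h.lower, h.pos, Real.pi_pos])
      (by linarith) (by linarith)
  rw [Real.sin_sub_pi] at p1
  have p2 : ‖a η‖ ^ k ≤ ‖a η‖ ^ 2 :=
    pow_le_pow_of_le_one hr.le h.norm_lt_one.le (by linarith [h.four_le])
  calc ‖a η‖ ^ (k + 1) * -Real.sin ((k + 2) * η) ≤ ‖a η‖ ^ (k + 1) * Real.sin (2 * η) := by gcongr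
    _ = ‖a η‖ ^ k * Real.sin η := by rw [pow_succ, mul_assoc, e2]
    _ ≤ _ := by gcongr

/-- Places f₂(b₀) to the right of the edge from z_{k-2} to z_{k-1}. The sine decreases from (k-2)η
to (k-1)η, and the coefficients compare as 3/8 > 1/4 ≥ ‖a‖⁵. -/
lemma b₀_bound (h : Admissible k η) (hkη : k * η ≤ Real.pi) :
    0 ≤ (1 - ‖a η‖ ^ 2) * (1 - ‖a η‖ ^ 4) * Real.sin ((k - 2) * η)
      - ‖a η‖ ^ 5 * Real.sin ((k - 1) * η) + ‖a η‖ ^ (k - 1) * Real.sin η := by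
  have hs := h.sin_pos
  have hr := h.norm_pos
  have hr1 := h.norm_lt_one
  have hk := h.four_le_real
  have hx := norm_a_sq_le h.pos (h.le_quarter hkη)
  have p0 : 0 ≤ Real.sin ((k - 2) * η) := h.sin_nonneg (by linarith) (by linarith)
  have p1 : Real.sin ((k - 1) * η) ≤ Real.sin ((k - 2) * η) := by
    have e := Real.sin_sub_sin (((k : ℝ) - 1) * η) ((k - 2) * η)
    have s1 : 0 ≤ Real.sin ((((k : ℝ) - 1) * η - (k - 2) * η) / 2) :=
      Real.sin_nonneg_of_nonneg_of_le_pi (by linarith [h.pos]) (by linarith [h.lt_third, h.pos])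
    have s2 : Real.cos ((((k : ℝ) - 1) * η + (k - 2) * η) / 2) ≤ 0 := by
      apply Real.cos_nonpos_of_pi_div_two_le_of_le
      -- The mean angle is (2k-3)η/2, and 2k - 3 ≥ k + 1 exactly when k ≥ 4.
      · nlinarith [h.lower, h.pos]
      · nlinarith [h.upper, h.pos, Real.pi_pos]
    have := mul_nonpos_of_nonneg_of_nonpos s1 s2
    linarith
  have p2 : ‖a η‖ ^ 5 ≤ ‖a η‖ ^ 4 := pow_le_pow_of_le_one hr.le hr1.le (by norm_num)
  have p3 : ‖a η‖ ^ 4 ≤ 1 / 4 := by nlinarith [sq_nonneg ‖a η‖]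
  have p4 : 3 / 8 ≤ (1 - ‖a η‖ ^ 2) * (1 - ‖a η‖ ^ 4) := by nlinarith
  have p5 : ‖a η‖ ^ 5 * Real.sin ((k - 1) * η) ≤ ‖a η‖ ^ 5 * Real.sin ((k - 2) * η) := by gcongr
  have p6 : 0 ≤ ‖a η‖ ^ (k - 1) * Real.sin η := by positivity
  nlinarith

/-- Used to place w₀ = f₂(z₀), which is not in the vertex list, to the right of the edge into
z_{k-1}; `w_zero_bound'` does so for the edge into z_k. -/
lemma w_zero_bound (h : Admissible k η) :
    0 ≤ (1 - ‖a η‖ ^ 2 - ‖a η‖ ^ 4) * Real.sin ((k - 2) * η) + ‖a η‖ ^ (k - 1) * Real.sin η := by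
  have hs := h.sin_pos
  have hr := h.norm_pos
  have hr1 := h.norm_lt_one
  have hk := h.four_le_real
  have p0 : 0 ≤ Real.sin ((k - 2) * η) := h.sin_nonneg (by linarith) (by linarith)
  by_cases hk4 : k = 4
  · subst hk4
    have e2 := norm_a_mul_sin_two h.cos_pos
    rw [show (((4 : ℕ) : ℝ) - 2) * η = 2 * η by push_cast; ring] at *
    have : (1 - ‖a η‖ ^ 2 - ‖a η‖ ^ 4) * Real.sin (2 * η) + ‖a η‖ ^ (4 - 1) * Real.sin η
        = (1 - ‖a η‖ ^ 2) * Real.sin (2 * η) := by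
      rw [← e2]; norm_num; ring
    rw [this]
    exact mul_nonneg (by nlinarith) p0
  · have := h.coeff_nonneg (h.eq_four_or.resolve_left hk4)
    positivity

lemma w_zero_bound' (h : Admissible k η) (hkη : k * η ≤ Real.pi) :
    0 ≤ (1 - ‖a η‖ ^ 2 - ‖a η‖ ^ 4) * Real.sin ((k - 1) * η) + ‖a η‖ ^ k * Real.sin η := by
  have hs := h.sin_pos
  have hr := h.norm_pos
  have p0 : 0 ≤ Real.sin ((k - 1) * η) := h.sin_nonneg (by linarith [h.four_le_real]) le_rfl
  have := h.coeff_nonneg (h.le_quarter hkη)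
  positivity

end Admissible

/-! ### Vertices and edges in polar form -/

lemma dir_zero : dir 0 = 1 := by apply Complex.ext <;> simp

lemma dir_mul_dir (s t : ℝ) : dir s * dir t = dir (s + t) := by
  apply Complex.ext <;> simp [Real.cos_add, Real.sin_add]

lemma dir_neg_pi_add (t : ℝ) : dir (-Real.pi + t) = -dir t := by
  apply Complex.ext <;> simp [Real.cos_add, Real.sin_add]

lemma sin_neg_pi_add (x : ℝ) : Real.sin (-Real.pi + x) = -Real.sin x := by
  simp [Real.sin_add]

lemma conj_dir (t : ℝ) : conj (dir t) = dir (-t) := by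
  apply Complex.ext <;> simp

lemma norm_dir (t : ℝ) : ‖dir t‖ = 1 := by
  rw [← sq_eq_sq₀ (norm_nonneg _) zero_le_one, Complex.sq_norm, Complex.normSq_apply]
  simp only [dir_re, dir_im]
  nlinarith [Real.sin_sq_add_cos_sq t]

lemma cross_dir_one (t : ℝ) : cross (dir t) 1 = Real.sin t := by
  rw [← dir_zero, cross_dir_dir, sub_zero]

/-- A line may be based at any of its points. -/
lemma cross_sub_eq_of_edge {p q x : ℂ} {ρ t : ℝ} (h : q - p = ρ * dir t) :
    cross (dir t) (x - q) = cross (dir t) (x - p) := by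
  rw [show x - q = x - p - (q - p) by ring, h, cross_sub_right, cross_real_mul_right, cross_self]
  ring

section Points

variable {η : ℝ}

lemma a_pow_eq (hc : 0 < Real.cos η) (n : ℕ) : a η ^ n = ((‖a η‖ ^ n : ℝ) : ℂ) * dir (n * η) := by
  induction n with
  | zero => simp [dir_zero]
  | succ n ih =>
    rw [pow_succ, ih]
    nth_rw 2 [a_eq_mul_dir hc]
    rw [show ((n + 1 : ℕ) : ℝ) * η = n * η + η by push_cast; ring, ← dir_mul_dir]
    push_cast
    ring

lemma conj_a_eq (hc : 0 < Real.cos η) : conj (a η) = (‖a η‖ : ℂ) * dir (-η) := by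
  nth_rw 1 [a_eq_mul_dir hc]
  rw [map_mul, conj_dir, Complex.conj_ofReal]

/-- The real part of a is 1/2. Hence |a|² = a(1-a), and identities between vertices become
polynomial identities in a. -/
lemma conj_a_eq_one_sub (hc : 0 < Real.cos η) : conj (a η) = 1 - a η := by
  rw [conj_a_eq hc]
  nth_rw 2 [a_eq_mul_dir hc]
  have h := two_mul_norm_a_mul_cos hc
  apply Complex.ext
  · simp only [Complex.re_ofReal_mul, Complex.sub_re, Complex.one_re, dir_re, Real.cos_neg]
    linarith
  · simp

lemma norm_sq_eq (hc : 0 < Real.cos η) : (‖a η‖ : ℂ) ^ 2 = a η * (1 - a η) := by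
  rw [← conj_a_eq_one_sub hc, Complex.mul_conj, Complex.normSq_eq_norm_sq]
  push_cast; rfl

lemma f₁_sub (hc : 0 < Real.cos η) (x p : ℂ) (t : ℝ) :
    cross (dir t) (f₁ η x - f₁ η p) = ‖a η‖ * cross (dir (t - η)) (x - p) := by
  rw [← cross_dir_mul, f₁, f₁, ← mul_sub, ← a_eq_mul_dir hc]

lemma f₂_sub (hc : 0 < Real.cos η) (x p : ℂ) (t : ℝ) :
    cross (dir t) (f₂ η x - f₂ η p) = ‖a η‖ * cross (dir (t + η + Real.pi)) (x - p) := by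
  rw [← cross_dir_neg_mul, f₂, f₂, ← conj_a_eq hc]
  congr 1; ring

/-- The test for invariance: p is to be extremal in the pulled-back direction, and then only the
image of p has to be checked. The angle γ is free modulo 2π, so it can be moved into the range of
the cone lemmas. -/
lemma f₁_cross_nonpos (hc : 0 < Real.cos η) {x p q : ℂ} {t γ : ℝ} (hγ : dir γ = dir (t - η))
    (h : cross (dir γ) (x - p) ≤ 0) (h' : cross (dir t) (f₁ η p - q) ≤ 0) :
    cross (dir t) (f₁ η x - q) ≤ 0 := by
  rw [show f₁ η x - q = (f₁ η x - f₁ η p) + (f₁ η p - q) by ring, cross_add_right, f₁_sub hc, ← hγ]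
  have := mul_nonpos_of_nonneg_of_nonpos (norm_nonneg (a η)) h
  linarith

lemma f₂_cross_nonpos (hc : 0 < Real.cos η) {x p q : ℂ} {t γ : ℝ} (hγ : dir γ = dir (t + η + Real.pi))
    (h : cross (dir γ) (x - p) ≤ 0) (h' : cross (dir t) (f₂ η p - q) ≤ 0) :
    cross (dir t) (f₂ η x - q) ≤ 0 := by
  rw [show f₂ η x - q = (f₂ η x - f₂ η p) + (f₂ η p - q) by ring, cross_add_right, f₂_sub hc, ← hγ]
  have := mul_nonpos_of_nonneg_of_nonpos (norm_nonneg (a η)) h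
  linarith

lemma f₁_z (j : ℕ) : f₁ η (z η j) = z η (j + 1) := by
  rw [f₁, z, z]; ring

lemma f₂_z (hc : 0 < Real.cos η) (j : ℕ) : f₂ η (z η j) = w η j := by
  rw [f₂, z, w, conj_a_eq_one_sub hc, norm_sq_eq hc]; ring

lemma f₁_w (hc : 0 < Real.cos η) (j : ℕ) : f₁ η (w η j) = w η (j + 1) - conj (a η) := by
  rw [f₁, w, w, conj_a_eq_one_sub hc]; ring

lemma f₂_w_succ (hc : 0 < Real.cos η) (j : ℕ) :
    f₂ η (w η (j + 1)) = a η + (c η : ℂ) * (‖a η‖ : ℂ) ^ 4 * a η ^ j := by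
  rw [f₂, w, conj_a_eq_one_sub hc, show (‖a η‖ : ℂ) ^ 4 = ((‖a η‖ : ℂ) ^ 2) ^ 2 by ring,
    norm_sq_eq hc]
  ring

lemma f₂_w_one (hc : 0 < Real.cos η) : f₂ η (w η 1) = b₀ η := by
  rw [show (1 : ℕ) = 0 + 1 from rfl, f₂_w_succ hc, b₀, pow_zero, mul_one]

lemma z_eq (hc : 0 < Real.cos η) (j : ℕ) : z η j = ((c η * ‖a η‖ ^ (j + 1) : ℝ) : ℂ) * dir ((j + 1) * η) := by
  rw [z, a_pow_eq hc]; push_cast; ring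

lemma w_eq (hc : 0 < Real.cos η) (j : ℕ) : w η j = 1 - ((c η * ‖a η‖ ^ (j + 2) : ℝ) : ℂ) * dir (j * η) := by
  rw [w, a_pow_eq hc]; push_cast; ring

lemma cross_z (hc : 0 < Real.cos η) (t : ℝ) (j : ℕ) :
    cross (dir t) (z η j) = c η * ‖a η‖ ^ (j + 1) * Real.sin (t - (j + 1) * η) := by
  rw [z_eq hc, cross_real_mul_right, cross_dir_dir]

lemma cross_w (hc : 0 < Real.cos η) (t : ℝ) (j : ℕ) : cross (dir t) (w η j)
    = Real.sin t - c η * ‖a η‖ ^ (j + 2) * Real.sin (t - j * η) := by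
  rw [w_eq hc, cross_sub_right, cross_real_mul_right, cross_dir_dir, cross_dir_one]

lemma cross_conj_a (hc : 0 < Real.cos η) (t : ℝ) : cross (dir t) (conj (a η)) = ‖a η‖ * Real.sin (t + η) := by
  rw [conj_a_eq hc, cross_real_mul_right, cross_dir_dir, sub_neg_eq_add]

lemma cross_a_pow (hc : 0 < Real.cos η) (t : ℝ) (n : ℕ) :
    cross (dir t) (a η ^ n) = ‖a η‖ ^ n * Real.sin (t - n * η) := by
  rw [a_pow_eq hc, cross_real_mul_right, cross_dir_dir]

lemma z_edge (hc : 0 < Real.cos η) (j : ℕ) :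
    z η (j + 1) - z η j = ((c η * ‖a η‖ ^ (j + 2) : ℝ) : ℂ) * dir (-Real.pi + j * η) := by
  have h : z η (j + 1) - z η j = -((c η : ℂ) * (‖a η‖ : ℂ) ^ 2 * a η ^ j) := by
    rw [z, z, norm_sq_eq hc]; ring
  rw [h, a_pow_eq hc, dir_neg_pi_add]
  push_cast; ring

lemma w_edge (hc : 0 < Real.cos η) (m : ℕ) :
    w η (m + 1 + 1) - w η (m + 1) = ((c η * ‖a η‖ ^ (m + 4) : ℝ) : ℂ) * dir (m * η) := by
  have h : w η (m + 1 + 1) - w η (m + 1)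
      = (c η : ℂ) * (‖a η‖ : ℂ) ^ 2 * (‖a η‖ : ℂ) ^ 2 * a η ^ m := by
    rw [w, w]
    nth_rw 4 [norm_sq_eq hc]
    ring
  rw [h, a_pow_eq hc]
  push_cast; ring

end Points

namespace Admissible

variable {k : ℕ} {η : ℝ}

lemma one_sub_pos (h : Admissible k η) : 0 < 1 - ‖a η‖ ^ 4 := by
  have := pow_lt_one₀ h.norm_pos.le h.norm_lt_one (n := 4) (by norm_num)
  linarith

lemma c_pos (h : Admissible k η) : 0 < c η := one_div_pos.2 h.one_sub_pos

lemma c_mul (h : Admissible k η) : c η * (1 - ‖a η‖ ^ 4) = 1 :=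
  one_div_mul_cancel h.one_sub_pos.ne'

/-- Closes the cycle z₀, z₁, z₂, w₂, z₀ under f₁, f₁, f₂, f₂; it amounts to c = 1 + c|a|⁴. -/
lemma f₂_w_two (h : Admissible k η) : f₂ η (w η 2) = z η 0 := by
  have e : (c η : ℂ) * (1 - (‖a η‖ : ℂ) ^ 4) = 1 := by exact_mod_cast h.c_mul
  rw [show (2 : ℕ) = 1 + 1 from rfl, f₂_w_succ h.cos_pos, z]
  linear_combination (-a η) * e

lemma b₀_edge (h : Admissible k η) :
    z η 0 - b₀ η = ((c η * ‖a η‖ ^ 5 : ℝ) : ℂ) * dir (-Real.pi + -η) := by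
  have e : (c η : ℂ) * (1 - (‖a η‖ : ℂ) ^ 4) = 1 := by exact_mod_cast h.c_mul
  have h1 : z η 0 - b₀ η = -((c η : ℂ) * (‖a η‖ : ℂ) ^ 4 * conj (a η)) := by
    rw [z, b₀, conj_a_eq_one_sub h.cos_pos]
    linear_combination (a η) * e
  rw [h1, conj_a_eq h.cos_pos, dir_neg_pi_add]
  push_cast; ring

lemma cross_long_edge (h : Admissible k η) (t : ℝ) :
    cross (dir t) (w η 1 - z η k) = Real.sin t - c η * ‖a η‖ ^ 3 * Real.sin (t - η)
      - c η * ‖a η‖ ^ (k + 1) * Real.sin (t - (k + 1) * η) := by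
  rw [cross_sub_right, cross_w h.cos_pos, cross_z h.cos_pos, Nat.cast_one, one_mul]

end Admissible

/-! ### The inclination of the long edge -/

/-- `θ` is the inclination of the edge from `z_k` to `w_1`. -/
structure Inclination (k : ℕ) (η θ : ℝ) : Prop extends Admissible k η where
  theta_pos : 0 < θ
  theta_le : θ ≤ η
  theta_lower : Real.pi ≤ k * η + θ
  theta_upper : (k - 1) * η + θ < Real.pi
  edge : ∃ ρ : ℝ, 0 < ρ ∧ w η 1 - z η k = ρ * dir (-θ)

/-- With θ = arg(w₁ - z_k), the cross product with direction t is a positive multiple of sin(t + θ).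
The test directions 0, -η, kη and (k-1)η give the four bounds on θ. -/
lemma Admissible.exists_inclination {k : ℕ} {η : ℝ} (h : Admissible k η) :
    ∃ θ, Inclination k η θ := by
  have hc := h.cos_pos
  have hcp := h.c_pos
  have hcm := h.c_mul
  have hr := h.norm_pos
  have hπ := Real.pi_pos
  have hk := h.four_le_real
  have e2 := norm_a_mul_sin_two hc
  set u := w η 1 - z η k with hu
  set θ := Complex.arg u with hθ
  have hpolar : u = (‖u‖ : ℂ) * dir (-θ) := by
    apply Complex.ext
    · rw [Complex.re_ofReal_mul, dir_re, Real.cos_neg, hθ, Complex.norm_mul_cos_arg]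
    · rw [Complex.im_ofReal_mul, dir_im, Real.sin_neg, neg_neg, hθ, Complex.norm_mul_sin_arg]
  have hcross : ∀ t, cross (dir t) u = ‖u‖ * Real.sin (t + θ) := fun t => by
    conv_lhs => rw [hpolar, cross_real_mul_right, cross_dir_dir, sub_neg_eq_add]
  have h0 : 0 < cross (dir 0) u := by
    rw [h.cross_long_edge]
    have e1 := h.sin_succ_bound
    have : Real.sin 0 - c η * ‖a η‖ ^ 3 * Real.sin (0 - η)
        - c η * ‖a η‖ ^ (k + 1) * Real.sin (0 - (k + 1) * η)
        = c η * ‖a η‖ * (‖a η‖ ^ 2 * Real.sin η + ‖a η‖ ^ k * Real.sin ((k + 1) * η)) := by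
      rw [zero_sub, zero_sub, Real.sin_neg, Real.sin_neg, Real.sin_zero]; ring
    rw [this]
    positivity
  have hupos : 0 < ‖u‖ := by
    rw [hcross] at h0
    rcases (norm_nonneg u).eq_or_lt with h1 | h1
    · rw [← h1, zero_mul] at h0; exact absurd h0 (lt_irrefl 0)
    · exact h1
  have hθ0 : 0 < θ := by
    rw [hcross, zero_add] at h0
    by_contra! hneg
    have := Real.sin_nonpos_of_nonpos_of_neg_pi_le hneg (Complex.neg_pi_lt_arg u).le
    nlinarith
  have hθπ : θ ≤ Real.pi := Complex.arg_le_pi u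
  have hθη : θ ≤ η := by
    have h1 : cross (dir (-η)) u ≤ 0 := by
      rw [h.cross_long_edge]
      have e1 := h.sin_add_two_bound
      have : Real.sin (-η) - c η * ‖a η‖ ^ 3 * Real.sin (-η - η)
          - c η * ‖a η‖ ^ (k + 1) * Real.sin (-η - (k + 1) * η)
          = -(c η * ((1 - ‖a η‖ ^ 2 - ‖a η‖ ^ 4) * Real.sin η
            - ‖a η‖ ^ (k + 1) * Real.sin ((k + 2) * η))) := by
        rw [show -η - η = -(2 * η) by ring, show -η - ((k : ℝ) + 1) * η = -((k + 2) * η) by ring,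
          Real.sin_neg, Real.sin_neg, Real.sin_neg]
        linear_combination c η * ‖a η‖ ^ 2 * e2 + Real.sin η * hcm
      rw [this, neg_nonpos]
      positivity
    rw [hcross] at h1
    by_contra! hlt
    have := Real.sin_pos_of_pos_of_lt_pi (x := -η + θ) (by linarith) (by linarith [h.pos])
    nlinarith
  refine ⟨θ, h, hθ0, hθη, ?_, ?_, ‖u‖, hupos, hpolar⟩
  · have h1 : cross (dir (k * η)) u ≤ 0 := by
      rw [h.cross_long_edge]
      have : Real.sin (k * η) - c η * ‖a η‖ ^ 3 * Real.sin (k * η - η)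
          - c η * ‖a η‖ ^ (k + 1) * Real.sin (k * η - (k + 1) * η) = c η * Phi (k + 1) η := by
        rw [Phi, show (((k + 1 : ℕ) : ℝ) - 1) * η = k * η by push_cast; ring,
          show (((k + 1 : ℕ) : ℝ) - 2) * η = k * η - η by push_cast; ring,
          show (k : ℝ) * η - (k + 1) * η = -η by ring, Real.sin_neg]
        linear_combination (-Real.sin (k * η)) * hcm
      rw [this]
      exact mul_nonpos_of_nonneg_of_nonpos hcp.le h.Phi_succ
    rw [hcross] at h1
    by_contra! hlt
    have := Real.sin_pos_of_pos_of_lt_pi (x := k * η + θ) (by have := h.pos; positivity) hlt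
    nlinarith
  · have h1 : 0 < cross (dir ((k - 1) * η)) u := by
      rw [h.cross_long_edge]
      have : Real.sin ((k - 1) * η) - c η * ‖a η‖ ^ 3 * Real.sin ((k - 1) * η - η)
          - c η * ‖a η‖ ^ (k + 1) * Real.sin ((k - 1) * η - (k + 1) * η) = c η * Phi k η := by
        rw [Phi, show (k - 1) * η - η = (k - 2) * η by ring,
          show ((k : ℝ) - 1) * η - (k + 1) * η = -(2 * η) by ring, Real.sin_neg]
        linear_combination (-Real.sin ((k - 1) * η)) * hcm + c η * ‖a η‖ ^ k * e2
      rw [this]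
      exact mul_pos hcp h.Phi_pos
    rw [hcross] at h1
    by_contra! hle
    have := Real.sin_nonneg_of_nonneg_of_le_pi (x := (k - 1) * η + θ - Real.pi) (by linarith)
      (by linarith [h.upper])
    rw [Real.sin_sub_pi] at this
    nlinarith

/-! ### The polygon and its half-planes -/

/-- The vertices `b₀, z₀, …, z_k, w₁, …, w_k, b₀`. -/
noncomputable def vertex (k : ℕ) (η : ℝ) (i : ℕ) : ℂ :=
  if i = 0 then b₀ η else if i ≤ k + 1 then z η (i - 1)
    else if i ≤ 2 * k + 1 then w η (i - (k + 1)) else b₀ η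

/-- The direction of the edge following the vertex `i`. -/
noncomputable def angle (k : ℕ) (η θ : ℝ) (i : ℕ) : ℝ :=
  if i ≤ k then -Real.pi + ((i : ℝ) - 1) * η else if i = k + 1 then -θ
    else if i ≤ 2 * k then ((i : ℝ) - (k + 2)) * η else Real.pi - η - θ

/-- The intersection of the half-planes to the right of the edges. -/
structure Inside (k : ℕ) (η θ : ℝ) (x : ℂ) : Prop where
  right_z : ∀ i ≤ k, cross (dir (-Real.pi + ((i : ℝ) - 1) * η)) (x - z η i) ≤ 0
  right_long : cross (dir (-θ)) (x - z η k) ≤ 0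
  right_w : ∀ m, m + 1 < k → cross (dir (m * η)) (x - w η (m + 1)) ≤ 0
  right_last : cross (dir (Real.pi - η - θ)) (x - w η k) ≤ 0

section Vertex

variable {k : ℕ} {η θ : ℝ}

lemma vertex_zero : vertex k η 0 = b₀ η := by simp [vertex]

lemma vertex_z {j : ℕ} (hj : j ≤ k) : vertex k η (j + 1) = z η j := by
  simp [vertex, hj]

lemma vertex_w {m : ℕ} (hm : m + 1 ≤ k) : vertex k η (k + 2 + m) = w η (m + 1) := by
  rw [vertex, if_neg (by omega), if_neg (by omega), if_pos (by omega)]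
  congr 1; omega

lemma vertex_last : vertex k η (2 * k + 2) = b₀ η := by
  rw [vertex, if_neg (by omega), if_neg (by omega), if_neg (by omega)]

lemma angle_z {i : ℕ} (hi : i ≤ k) : angle k η θ i = -Real.pi + ((i : ℝ) - 1) * η := by
  simp [angle, hi]

lemma angle_long : angle k η θ (k + 1) = -θ := by simp [angle]

lemma angle_w {m : ℕ} (hm : m + 1 < k) : angle k η θ (k + 2 + m) = m * η := by
  rw [angle, if_neg (by omega), if_neg (by omega), if_pos (by omega)]
  push_cast; ring

lemma angle_last (hk : 1 ≤ k) : angle k η θ (2 * k + 1) = Real.pi - η - θ := by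
  rw [angle, if_neg (by omega), if_neg (by omega), if_neg (by omega)]

lemma vertex_w_last (hk : 1 ≤ k) : vertex k η (2 * k + 1) = w η k := by
  have := vertex_w (k := k) (η := η) (m := k - 1) (by omega)
  rwa [show k + 2 + (k - 1) = 2 * k + 1 by omega, show k - 1 + 1 = k by omega] at this

/-- An edge is `b₀z₀`, one of the `z_m z_{m+1}`, `z_k w₁`, one of the `w_{m+1} w_{m+2}`, or
`w_k b₀`. -/
lemma edge_cases {i : ℕ} (hi : i < 2 * k + 2) :
    i = 0 ∨ (∃ m < k, i = m + 1) ∨ i = k + 1 ∨ (∃ m, m + 1 < k ∧ i = k + 2 + m) ∨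
      i = 2 * k + 1 := by
  by_cases h0 : i = 0
  · exact Or.inl h0
  by_cases h1 : i ≤ k
  · exact Or.inr (Or.inl ⟨i - 1, by omega, by omega⟩)
  by_cases h2 : i = k + 1
  · exact Or.inr (Or.inr (Or.inl h2))
  by_cases h3 : i = 2 * k + 1
  · exact Or.inr (Or.inr (Or.inr (Or.inr h3)))
  · exact Or.inr (Or.inr (Or.inr (Or.inl ⟨i - (k + 2), by omega, by omega⟩)))

lemma length_vertexList : (vertexList η k).length = 2 * k + 2 := by
  simp [vertexList]; omega

lemma getElem_vertexList (i : ℕ) (hi : i < (vertexList η k).length) :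
    (vertexList η k)[i] = vertex k η i := by
  have hi' := hi
  rw [length_vertexList] at hi'
  rcases i with _ | i
  · simp [vertexList, vertex_zero]
  · by_cases h : i < k + 1
    · rw [vertex_z (by omega)]
      simp [vertexList, List.getElem_append_left, h]
    · obtain ⟨m, rfl⟩ : ∃ m, i = k + 1 + m := ⟨i - (k + 1), by omega⟩
      have hv : vertex k η (k + 1 + m + 1) = w η (m + 1) := by
        rw [show k + 1 + m + 1 = k + 2 + m by omega, vertex_w (by omega)]
      rw [hv]
      simp [vertexList, List.getElem_append_right]

end Vertex

namespace Inclination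

variable {k : ℕ} {η θ : ℝ}

/-- The map f₂ sends z_k to w_k and w₁ to b₀, so this edge is the image of the long edge and needs
no estimate of its own. -/
lemma last_edge (h : Inclination k η θ) :
    ∃ ρ : ℝ, 0 < ρ ∧ b₀ η - w η k = ρ * dir (Real.pi - η - θ) := by
  obtain ⟨ρ, hρ, he⟩ := h.edge
  have hc := h.cos_pos
  refine ⟨‖a η‖ * ρ, mul_pos h.norm_pos hρ, ?_⟩
  have h1 : b₀ η - w η k = -(conj (a η) * (w η 1 - z η k)) := by
    rw [← f₂_w_one hc, ← f₂_z hc k, f₂, f₂]; ring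
  rw [h1, he, conj_a_eq hc, show Real.pi - η - θ = (-Real.pi + (-η + -θ)) + 2 * Real.pi by ring,
    dir_add_two_pi, dir_neg_pi_add, ← dir_mul_dir]
  push_cast; ring

lemma edge_eq (h : Inclination k η θ) {i : ℕ} (hi : i < 2 * k + 2) :
    ∃ ρ : ℝ, 0 < ρ ∧ vertex k η (i + 1) - vertex k η i = ρ * dir (angle k η θ i) := by
  have hk := h.four_le
  have hcp := h.c_pos
  have hr := h.norm_pos
  rcases edge_cases hi with rfl | ⟨m, hm, rfl⟩ | rfl | ⟨m, hm, rfl⟩ | rfl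
  · refine ⟨c η * ‖a η‖ ^ 5, by positivity, ?_⟩
    rw [vertex_zero, vertex_z (Nat.zero_le k), angle_z (Nat.zero_le k), h.b₀_edge]
    simp
  · refine ⟨c η * ‖a η‖ ^ (m + 2), by positivity, ?_⟩
    rw [vertex_z (by omega), vertex_z (by omega), angle_z (by omega), z_edge h.cos_pos]
    simp
  · rw [show k + 1 + 1 = k + 2 + 0 by omega, vertex_w (by omega), vertex_z le_rfl, angle_long]
    exact h.edge
  · refine ⟨c η * ‖a η‖ ^ (m + 4), by positivity, ?_⟩
    rw [show k + 2 + m + 1 = k + 2 + (m + 1) by omega, vertex_w (by omega), vertex_w (by omega),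
      angle_w hm, w_edge h.cos_pos]
  · rw [vertex_last, vertex_w_last (by omega), angle_last (by omega)]
    exact h.last_edge

/-- Every turn is η, except those at the ends of the long edge and of its f₂-image, which are π - θ
- (k-1)η at z_k and w_k, and θ at w₁ and b₀. -/
lemma clockwisePolygon (h : Inclination k η θ) : ClockwisePolygon (2 * k + 2) (vertex k η)
    (fun i => ‖vertex k η (i + 1) - vertex k η i‖) (angle k η θ) := by
  have hk := h.four_le
  have hπ := Real.pi_pos
  have h0 := h.pos
  have h3 := h.lt_third
  have t1 := h.theta_pos
  have t2 := h.theta_le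
  have t4 := h.theta_upper
  have gap : ∀ i, i + 1 < 2 * k + 2 → angle k η θ i < angle k η θ (i + 1) ∧
      angle k η θ (i + 1) < angle k η θ i + Real.pi := by
    intro i hi
    rcases edge_cases (show i < 2 * k + 2 by omega) with rfl | ⟨m, hm, rfl⟩ | rfl | ⟨m, hm, rfl⟩ | rfl
    · rw [angle_z (by omega), angle_z (by omega)]
      push_cast
      constructor <;> linarith
    · rcases (show m + 1 ≤ k from hm).eq_or_lt with h1 | h1
      · rw [h1, angle_z le_rfl, angle_long]
        have : ((k : ℝ) - 1) * η ≥ 0 := mul_nonneg (by linarith [h.four_le_real]) h0.le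
        constructor <;> linarith
      · rw [angle_z (by omega), angle_z (by omega)]
        push_cast
        constructor <;> linarith
    · rw [angle_long, show k + 1 + 1 = k + 2 + 0 by omega, angle_w (by omega)]
      simp only [Nat.cast_zero, zero_mul]
      constructor <;> linarith
    · rcases (show m + 1 + 1 ≤ k from hm).eq_or_lt with h1 | h1
      · have e : (m : ℝ) = k - 2 := by rw [← h1]; push_cast; ring
        rw [angle_w (by omega), show k + 2 + m + 1 = 2 * k + 1 by omega, angle_last (by omega), e]
        have := mul_nonneg (show (0 : ℝ) ≤ k - 2 by linarith [h.four_le_real]) h0.le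
        constructor <;> linarith
      · rw [show k + 2 + m + 1 = k + 2 + (m + 1) by omega, angle_w (by omega), angle_w (by omega)]
        push_cast
        constructor <;> linarith
    · omega
  have norm_eq : ∀ i < 2 * k + 2, 0 < ‖vertex k η (i + 1) - vertex k η i‖ ∧
      vertex k η (i + 1) - vertex k η i
        = (‖vertex k η (i + 1) - vertex k η i‖ : ℂ) * dir (angle k η θ i) := by
    intro i hi
    obtain ⟨ρ, hρ, he⟩ := h.edge_eq hi
    have : ‖vertex k η (i + 1) - vertex k η i‖ = ρ := by
      rw [he, norm_mul, norm_dir, mul_one, Complex.norm_real, Real.norm_of_nonneg hρ.le]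
    rw [this]
    exact ⟨hρ, he⟩
  refine ⟨by omega, by rw [vertex_last, vertex_zero], fun i hi => (norm_eq i hi).1,
    fun i hi => (norm_eq i hi).2, fun i hi => (gap i hi).1, fun i hi => (gap i hi).2, ?_, ?_⟩
  all_goals
    rw [show 2 * k + 2 - 1 = 2 * k + 1 by omega, angle_last (by omega), angle_z (Nat.zero_le k)]
    push_cast
    linarith

/-- `Inside` bases the edge into each z_i at its end, the polygon at its start; the rest is matching
of indices. -/
lemma cross_nonpos_of_inside (h : Inclination k η θ) {x : ℂ} (hx : Inside k η θ x) {i : ℕ}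
    (hi : i < 2 * k + 2) : cross (dir (angle k η θ i)) (x - vertex k η i) ≤ 0 := by
  have hk := h.four_le
  rcases edge_cases hi with rfl | ⟨m, hm, rfl⟩ | rfl | ⟨m, hm, rfl⟩ | rfl
  · obtain ⟨ρ, -, he⟩ := h.edge_eq hi
    rw [← cross_sub_eq_of_edge he, vertex_z (Nat.zero_le k), angle_z (Nat.zero_le k)]
    exact hx.right_z 0 (Nat.zero_le k)
  · obtain ⟨ρ, -, he⟩ := h.edge_eq hi
    rw [← cross_sub_eq_of_edge he, vertex_z (by omega), angle_z (by omega)]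
    exact hx.right_z (m + 1) (by omega)
  · rw [angle_long, vertex_z le_rfl]
    exact hx.right_long
  · rw [angle_w hm, vertex_w (by omega)]
    exact hx.right_w m hm
  · rw [angle_last (by omega), vertex_w_last (by omega)]
    exact hx.right_last

lemma inside_vertex (h : Inclination k η θ) {j : ℕ} (hj : j < 2 * k + 2) :
    Inside k η θ (vertex k η j) := by
  have hk := h.four_le
  have key : ∀ i < 2 * k + 2, cross (dir (angle k η θ i)) (vertex k η j - vertex k η i) ≤ 0 :=
    fun i hi => h.clockwisePolygon.cross_nonpos hi hj
  refine ⟨fun i hi => ?_, ?_, fun m hm => ?_, ?_⟩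
  · obtain ⟨ρ, -, he⟩ := h.edge_eq (show i < 2 * k + 2 by omega)
    have := key i (by omega)
    rwa [← cross_sub_eq_of_edge he, vertex_z hi, angle_z hi] at this
  · have := key (k + 1) (by omega)
    rwa [angle_long, vertex_z le_rfl] at this
  · have := key (k + 2 + m) (by omega)
    rwa [angle_w hm, vertex_w (by omega)] at this
  · have := key (2 * k + 1) (by omega)
    rwa [angle_last (by omega), vertex_w_last (by omega)] at this

lemma inside_z (h : Inclination k η θ) {j : ℕ} (hj : j ≤ k) : Inside k η θ (z η j) := by
  rw [← vertex_z hj]; exact h.inside_vertex (by omega)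

lemma inside_w (h : Inclination k η θ) {m : ℕ} (hm : m + 1 ≤ k) :
    Inside k η θ (w η (m + 1)) := by
  rw [← vertex_w hm]; exact h.inside_vertex (by omega)

end Inclination

/-! ### Directions supported at a vertex -/

namespace Inside

variable {k : ℕ} {η θ γ : ℝ} {x : ℂ}

lemma right_z' (hx : Inside k η θ x) (h : Inclination k η θ) {j : ℕ} (hj : j < k) :
    cross (dir (-Real.pi + j * η)) (x - z η j) ≤ 0 := by
  have := hx.right_z (j + 1) hj
  rw [show ((j + 1 : ℕ) : ℝ) - 1 = j by push_cast; ring] at this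
  rwa [cross_sub_eq_of_edge (z_edge h.cos_pos j)] at this

lemma right_w' (hx : Inside k η θ x) (h : Inclination k η θ) {m : ℕ} (hm : m + 1 < k) :
    cross (dir (m * η)) (x - w η (m + 1 + 1)) ≤ 0 := by
  rw [cross_sub_eq_of_edge (w_edge h.cos_pos m)]
  exact hx.right_w m hm

/-- Any direction between the edges meeting at a vertex supports the polygon there; the next lemmas
do the same at the other kinds of vertices. -/
lemma cone_z (hx : Inside k η θ x) (h : Inclination k η θ) {j : ℕ} (hj : j < k)
    (h1 : -Real.pi + ((j : ℝ) - 1) * η ≤ γ) (h2 : γ ≤ -Real.pi + j * η) :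
    cross (dir γ) (x - z η j) ≤ 0 :=
  cross_dir_nonpos_of_between h1 h2 (by linarith [h.pos]) (by linarith [h.lt_third, h.pos])
    (hx.right_z j hj.le) (hx.right_z' h hj)

lemma cone_z_last (hx : Inside k η θ x) (h : Inclination k η θ)
    (h1 : -Real.pi + ((k : ℝ) - 1) * η ≤ γ) (h2 : γ ≤ -θ) : cross (dir γ) (x - z η k) ≤ 0 := by
  have := mul_nonneg (show (0 : ℝ) ≤ k - 1 by linarith [h.four_le_real]) h.pos.le
  exact cross_dir_nonpos_of_between h1 h2 (by linarith [h.theta_upper])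
    (by linarith [h.theta_pos]) (hx.right_z k le_rfl) hx.right_long

lemma cone_w (hx : Inside k η θ x) (h : Inclination k η θ) {m : ℕ} (hm : m + 2 < k)
    (h1 : m * η ≤ γ) (h2 : γ ≤ (m + 1) * η) : cross (dir γ) (x - w η (m + 2)) ≤ 0 := by
  have h3 := hx.right_w (m + 1) (by omega)
  push_cast at h3
  exact cross_dir_nonpos_of_between h1 h2 (by linarith [h.pos]) (by linarith [h.lt_third, h.pos])
    (hx.right_w' h (by omega)) h3

lemma cone_w_last (hx : Inside k η θ x) (h : Inclination k η θ)
    (h1 : ((k : ℝ) - 2) * η ≤ γ) (h2 : γ ≤ Real.pi - η - θ) : cross (dir γ) (x - w η k) ≤ 0 := by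
  have hk := h.four_le
  have h3 := hx.right_w' h (m := k - 2) (by omega)
  rw [show k - 2 + 1 + 1 = k by omega, Nat.cast_sub (by omega), Nat.cast_ofNat] at h3
  have := mul_nonneg (show (0 : ℝ) ≤ k - 2 by linarith [h.four_le_real]) h.pos.le
  exact cross_dir_nonpos_of_between h1 h2 (by linarith [h.theta_upper])
    (by linarith [h.theta_pos, h.pos]) h3 hx.right_last

lemma cone_b₀ (hx : Inside k η θ x) (h : Inclination k η θ)
    (h1 : Real.pi - η - θ ≤ γ) (h2 : γ ≤ Real.pi - η) : cross (dir γ) (x - b₀ η) ≤ 0 := by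
  obtain ⟨ρ, -, he⟩ := h.last_edge
  have h3 := hx.right_z 0 (Nat.zero_le k)
  rw [show -Real.pi + (((0 : ℕ) : ℝ) - 1) * η = -Real.pi + -η by push_cast; ring,
    cross_sub_eq_of_edge h.b₀_edge, ← dir_add_two_pi,
    show -Real.pi + -η + 2 * Real.pi = Real.pi - η by ring] at h3
  refine cross_dir_nonpos_of_between h1 h2 (by linarith [h.theta_pos])
    (by linarith [h.theta_le, h.lt_third]) ?_ h3
  rw [cross_sub_eq_of_edge he]
  exact hx.right_last

end Inside

/-! ### Invariance of the polygon under f₁ and f₂ -/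

namespace Inclination

variable {k : ℕ} {η θ : ℝ} {x : ℂ}

lemma z_succ_right_w (h : Inclination k η θ) (hkη : k * η ≤ Real.pi) :
    cross (dir 0) (z η (k + 1) - w η 1) ≤ 0 := by
  have hcp := h.c_pos
  have hr := h.norm_pos
  have hb := h.neg_sin_add_two_le hkη
  have e : cross (dir 0) (z η (k + 1) - w η 1) = c η * ‖a η‖ *
      (‖a η‖ ^ (k + 1) * -Real.sin ((k + 2) * η) - ‖a η‖ ^ 2 * Real.sin η) := by
    rw [cross_sub_right, cross_z h.cos_pos, cross_w h.cos_pos,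
      show 0 - (((k + 1 : ℕ) : ℝ) + 1) * η = -((k + 2) * η) by push_cast; ring,
      show 0 - ((1 : ℕ) : ℝ) * η = -η by push_cast; ring, Real.sin_neg, Real.sin_neg, Real.sin_zero]
    ring
  rw [e]
  exact mul_nonpos_of_nonneg_of_nonpos (by positivity) (by linarith)

lemma w_succ_right_z (h : Inclination k η θ) (hkη : k * η ≤ Real.pi) :
    cross (dir (-Real.pi + -η)) (w η (k + 1) - conj (a η) - z η 0) ≤ 0 := by
  have hcp := h.c_pos
  have hr := h.norm_pos
  have hb := h.neg_sin_add_two_le hkη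
  have e2 := norm_a_mul_sin_two h.cos_pos
  have e : cross (dir (-Real.pi + -η)) (w η (k + 1) - conj (a η) - z η 0) = c η * ‖a η‖ ^ 2 *
      (‖a η‖ ^ (k + 1) * -Real.sin ((k + 2) * η) - ‖a η‖ ^ 2 * Real.sin η) := by
    rw [cross_sub_right, cross_sub_right, cross_z h.cos_pos, cross_w h.cos_pos,
      cross_conj_a h.cos_pos,
      show -Real.pi + -η - ((k + 1 : ℕ) : ℝ) * η = -Real.pi + -((k + 2) * η) by push_cast; ring,
      show -Real.pi + -η - (((0 : ℕ) : ℝ) + 1) * η = -Real.pi + -(2 * η) by push_cast; ring,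
      show -Real.pi + -η + η = -Real.pi + 0 by ring,
      sin_neg_pi_add, sin_neg_pi_add, sin_neg_pi_add, sin_neg_pi_add, Real.sin_neg, Real.sin_neg,
      Real.sin_neg, Real.sin_zero]
    linear_combination (-c η) * e2 - Real.sin η * h.c_mul
  rw [e]
  exact mul_nonpos_of_nonneg_of_nonpos (by positivity) (by linarith)

lemma f₁_inside (h : Inclination k η θ) (hx : Inside k η θ x) : Inside k η θ (f₁ η x) := by
  have hc := h.cos_pos
  have hr := h.norm_pos
  have h0 := h.pos
  have t1 := h.theta_pos
  have t2 := h.theta_le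
  have t3 := h.theta_lower
  have t4 := h.theta_upper
  have hπ := Real.pi_pos
  obtain ⟨n, rfl⟩ : ∃ n, k = n + 4 := ⟨k - 4, by have := h.four_le; omega⟩
  have hn : ((n + 4 : ℕ) : ℝ) = n + 4 := by push_cast; ring
  rw [hn] at t3 t4
  refine ⟨fun i hi => ?_, ?_, fun m hm => ?_, ?_⟩
  · rcases i with _ | i
    · rw [show -Real.pi + (((0 : ℕ) : ℝ) - 1) * η = -Real.pi + -η by push_cast; ring]
      have hd : dir (Real.pi - 2 * η) = dir (-Real.pi + -η - η) := by
        rw [← dir_add_two_pi (-Real.pi + -η - η)]; congr 1; ring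
      rcases le_or_gt ((n + 4 : ℕ) * η) Real.pi with hle | hgt
      · refine f₁_cross_nonpos hc hd (hx.cone_w_last h ?_ ?_) ?_
        · linarith
        · linarith
        · rw [f₁_w hc]
          exact h.w_succ_right_z hle
      · refine f₁_cross_nonpos hc hd (hx.cone_w h (m := n + 1) (by omega) ?_ ?_) ?_
        · push_cast; linarith
        · rw [hn] at hgt; push_cast; linarith
        -- The translation by conj a is parallel to the edge from b₀ to z₀, so the claim reduces to
        -- the vertex w_k.
        · rw [f₁_w hc, sub_right_comm, cross_sub_right, cross_conj_a hc,
            show -Real.pi + -η + η = -Real.pi + 0 by ring, sin_neg_pi_add, Real.sin_zero]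
          have := (h.inside_w (m := n + 3) (by omega)).right_z 0 (by omega)
          rw [show -Real.pi + (((0 : ℕ) : ℝ) - 1) * η = -Real.pi + -η by push_cast; ring] at this
          simpa using this
    · refine f₁_cross_nonpos hc ?_ (hx.right_z i (by omega)) ?_
      · congr 1; push_cast; ring
      · rw [f₁_z, sub_self]; simp [cross]
  -- The direction -θ - η lies in the cone at z_{k-1} exactly because (k-1)η + θ < π ≤ kη + θ.
  · refine f₁_cross_nonpos hc (γ := -θ - η) rfl (hx.cone_z h (j := n + 3) (by omega) ?_ ?_) ?_
    · push_cast; linarith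
    · push_cast; linarith
    · rw [f₁_z, sub_self]; simp [cross]
  · rcases m with _ | m
    · rw [Nat.cast_zero, zero_mul]
      have hd : dir (-η) = dir (0 - η) := by rw [zero_sub]
      rcases le_or_gt ((n + 4 : ℕ) * η) Real.pi with hle | hgt
      · refine f₁_cross_nonpos hc hd (hx.cone_z_last h ?_ ?_) ?_
        · linarith
        · linarith
        · rw [f₁_z]
          exact h.z_succ_right_w hle
      · rw [hn] at hgt
        refine f₁_cross_nonpos hc hd (hx.cone_z h (j := n + 3) (by omega) ?_ ?_) ?_
        · push_cast; linarith
        · push_cast; linarith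
        · rw [f₁_z]
          simpa using (h.inside_z (j := n + 4) le_rfl).right_w 0 (by omega)
    · refine f₁_cross_nonpos hc ?_ (hx.right_w' h (m := m) (by omega)) ?_
      · congr 1; push_cast; ring
      · rw [f₁_w hc, sub_right_comm, w_edge hc, cross_sub_right, cross_real_mul_right, cross_self,
          cross_conj_a hc, mul_zero, zero_sub, neg_nonpos]
        refine mul_nonneg hr.le ?_
        have : (m : ℝ) + 2 ≤ n + 4 - 1 := by
          have : ((m + 1 + 1 + 1 : ℕ) : ℝ) ≤ ((n + 4 : ℕ) : ℝ) := by exact_mod_cast hm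
          push_cast at this; linarith
        have := h.sin_nonneg (x := (m : ℝ) + 2) (by positivity) (by rw [hn]; exact this)
        rwa [show ((m + 1 : ℕ) : ℝ) * η + η = (m + 2) * η by push_cast; ring]
  · refine f₁_cross_nonpos hc (γ := Real.pi - η - θ - η) rfl
      (hx.cone_w h (m := n + 1) (by omega) ?_ ?_) ?_
    · push_cast; linarith
    · push_cast; linarith
    · rw [f₁_w hc, show n + 1 + 2 + 1 = n + 4 by omega, sub_right_comm (w η _), sub_self, zero_sub,
        show -conj (a η) = 0 - conj (a η) by ring, cross_sub_right, cross_conj_a hc,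
        show Real.pi - η - θ + η = Real.pi - θ by ring, Real.sin_pi_sub]
      have := mul_nonneg hr.le (Real.sin_nonneg_of_nonneg_of_le_pi t1.le (by linarith [h.lt_third]))
      simp only [cross, Complex.zero_im, Complex.zero_re, mul_zero, sub_zero, zero_sub, neg_nonpos]
      exact this

lemma w_zero_right_z (h : Inclination k η θ) {j : ℕ} (hb : 0 ≤ (1 - ‖a η‖ ^ 2 - ‖a η‖ ^ 4)
      * Real.sin (((j : ℝ) - 1) * η) + ‖a η‖ ^ j * Real.sin η) :
    cross (dir (-Real.pi + ((j : ℝ) - 1) * η)) (w η 0 - z η j) ≤ 0 := by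
  have e2 := norm_a_mul_sin_two h.cos_pos
  have e : cross (dir (-Real.pi + ((j : ℝ) - 1) * η)) (w η 0 - z η j) = -(c η *
      ((1 - ‖a η‖ ^ 2 - ‖a η‖ ^ 4) * Real.sin (((j : ℝ) - 1) * η) + ‖a η‖ ^ j * Real.sin η)) := by
    rw [cross_sub_right, cross_z h.cos_pos, cross_w h.cos_pos, Nat.cast_zero, zero_mul, sub_zero,
      show -Real.pi + ((j : ℝ) - 1) * η - (j + 1) * η = -Real.pi + -(2 * η) by ring,
      sin_neg_pi_add, sin_neg_pi_add, Real.sin_neg]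
    linear_combination (-c η * ‖a η‖ ^ j) * e2 + Real.sin (((j : ℝ) - 1) * η) * h.c_mul
  rw [e, neg_nonpos]
  exact mul_nonneg h.c_pos.le hb

lemma f₂_b₀_right_z (h : Inclination k η θ) (hkη : k * η ≤ Real.pi) :
    cross (dir (-Real.pi + ((k : ℝ) - 2) * η)) (f₂ η (b₀ η) - z η (k - 1)) ≤ 0 := by
  have hc := h.cos_pos
  have hb := h.b₀_bound hkη
  have e2 := norm_a_mul_sin_two hc
  obtain ⟨j, hj⟩ : ∃ j, k = j + 1 := ⟨k - 1, by have := h.four_le; omega⟩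
  have hj' : (k : ℝ) = j + 1 := by rw [hj]; push_cast; ring
  have hf : f₂ η (b₀ η) = ((1 - ‖a η‖ ^ 2 : ℝ) : ℂ) * 1
      - ((c η * ‖a η‖ ^ 4 : ℝ) : ℂ) * conj (a η) := by
    have h1 : ((1 - ‖a η‖ ^ 2 : ℝ) : ℂ) = 1 - a η * (1 - a η) := by
      rw [← norm_sq_eq hc]; push_cast; ring
    rw [f₂, b₀, h1, conj_a_eq_one_sub hc]
    push_cast
    ring
  have e : cross (dir (-Real.pi + ((k : ℝ) - 2) * η)) (f₂ η (b₀ η) - z η (k - 1)) = -(c η *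
      ((1 - ‖a η‖ ^ 2) * (1 - ‖a η‖ ^ 4) * Real.sin ((k - 2) * η)
      - ‖a η‖ ^ 5 * Real.sin ((k - 1) * η) + ‖a η‖ ^ (k - 1) * Real.sin η)) := by
    rw [show k - 1 = j by omega, hf, cross_sub_right, cross_sub_right, cross_real_mul_right,
      cross_real_mul_right, cross_dir_one, cross_conj_a hc, cross_z hc,
      show -Real.pi + ((k : ℝ) - 2) * η + η = -Real.pi + (k - 1) * η by ring,
      show -Real.pi + ((k : ℝ) - 2) * η - (j + 1) * η = -Real.pi + -(2 * η) by rw [hj']; ring,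
      sin_neg_pi_add, sin_neg_pi_add, sin_neg_pi_add, Real.sin_neg]
    linear_combination (-c η * ‖a η‖ ^ j) * e2
      + (1 - ‖a η‖ ^ 2) * Real.sin (((k : ℝ) - 2) * η) * h.c_mul
  rw [e, neg_nonpos]
  exact mul_nonneg h.c_pos.le hb

lemma f₂_w_right_z (h : Inclination k η θ) {m : ℕ} (hm : m + 1 < k) :
    cross (dir (-Real.pi + m * η)) (f₂ η (w η (m + 2)) - z η (m + 1)) ≤ 0 := by
  have hc := h.cos_pos
  have hr := h.norm_pos
  have e : (c η : ℂ) * (1 - (‖a η‖ : ℂ) ^ 4) = 1 := by exact_mod_cast h.c_mul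
  have hf : f₂ η (w η (m + 2)) - z η m = a η ^ 1 - a η ^ (m + 1) := by
    rw [show m + 2 = m + 1 + 1 by omega, f₂_w_succ hc, z]
    linear_combination (-a η ^ (m + 1)) * e
  rw [cross_sub_eq_of_edge (z_edge hc m), hf, cross_sub_right, cross_a_pow hc, cross_a_pow hc,
    show -Real.pi + m * η - ((1 : ℕ) : ℝ) * η = -Real.pi + (m - 1) * η by push_cast; ring,
    show -Real.pi + m * η - ((m + 1 : ℕ) : ℝ) * η = -Real.pi + -η by push_cast; ring,
    sin_neg_pi_add, sin_neg_pi_add, Real.sin_neg, neg_neg]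
  -- For m = 0 the point f₂(w₂) = z₀ lies on the line itself and the two terms cancel.
  rcases m with _ | m
  · rw [show (((0 : ℕ) : ℝ) - 1) * η = -η by push_cast; ring, Real.sin_neg]
    simp
  · have hs := h.sin_pos
    have h1 : ((m + 1 + 1 : ℕ) : ℝ) < k := by exact_mod_cast hm
    push_cast at h1
    have h2 := h.sin_nonneg (x := (((m + 1 : ℕ) : ℝ) - 1)) (by push_cast; simp)
      (by push_cast; linarith)
    have := mul_nonneg hr.le h2
    have : 0 ≤ ‖a η‖ ^ (m + 1 + 1) * Real.sin η := by positivity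
    rw [pow_one]
    linarith

lemma f₂_inside (h : Inclination k η θ) (hx : Inside k η θ x) : Inside k η θ (f₂ η x) := by
  have hc := h.cos_pos
  have h0 := h.pos
  have t1 := h.theta_pos
  have t2 := h.theta_le
  have t3 := h.theta_lower
  have t4 := h.theta_upper
  have hπ := Real.pi_pos
  have hk := h.four_le
  refine ⟨fun i hi => ?_, ?_, fun m hm => ?_, ?_⟩
  · rcases i with _ | i
    · refine f₂_cross_nonpos hc (γ := ((0 : ℕ) : ℝ) * η) ?_ (hx.right_w' h (m := 0) (by omega)) ?_
      · congr 1; push_cast; ring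
      · rw [show 0 + 1 + 1 = 2 from rfl, h.f₂_w_two, sub_self]; simp [cross]
    · have hd : ∀ γ, γ = ((i : ℝ) + 1) * η →
          dir γ = dir (-Real.pi + (((i + 1 : ℕ) : ℝ) - 1) * η + η + Real.pi) := fun γ hγ => by
        rw [hγ]; congr 1; push_cast; ring
      have hd' : ∀ γ, γ = ((i : ℝ) + 1) * η - 2 * Real.pi →
          dir γ = dir (-Real.pi + (((i + 1 : ℕ) : ℝ) - 1) * η + η + Real.pi) := fun γ hγ => by
        rw [← hd _ rfl, hγ, dir_sub_two_pi]
      by_cases h1 : i + 2 < k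
      · refine f₂_cross_nonpos hc (γ := ((i + 1 : ℕ) : ℝ) * η) (hd _ (by push_cast; ring))
          (hx.right_w (i + 1) h1) ?_
        have := h.f₂_w_right_z (m := i) (by omega)
        rwa [show ((i + 1 : ℕ) : ℝ) - 1 = i by push_cast; ring]
      · by_cases h2 : i + 2 = k
        · have hi' : (i : ℝ) = k - 2 := by rw [← h2]; push_cast; ring
          -- The pulled-back direction (k-1)η reaches π - η, the edge from b₀ to z₀ modulo 2π, when
          -- kη = π; there the supporting vertex changes from b₀ to z₀.
          rcases le_or_gt (k * η) Real.pi with hle | hgt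
          · refine f₂_cross_nonpos hc (γ := ((i : ℝ) + 1) * η) (hd _ rfl) (hx.cone_b₀ h ?_ ?_) ?_
            · rw [hi']; linarith
            · rw [hi']; linarith
            · have := h.f₂_b₀_right_z hle
              rw [show k - 1 = i + 1 by omega] at this
              rwa [show ((i + 1 : ℕ) : ℝ) - 1 = k - 2 by rw [← hi']; push_cast; ring]
          · refine f₂_cross_nonpos hc (γ := ((i : ℝ) + 1) * η - 2 * Real.pi) (hd' _ rfl)
              (hx.cone_z h (j := 0) (by omega) ?_ ?_) ?_
            · rw [hi']; push_cast; linarith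
            · rw [hi']; push_cast; linarith
            · rw [f₂_z hc]
              refine h.w_zero_right_z ?_
              have := h.w_zero_bound
              rw [show k - 1 = i + 1 by omega] at this
              rwa [show ((i + 1 : ℕ) : ℝ) - 1 = k - 2 by rw [← hi']; push_cast; ring]
        · have h3 : i + 1 = k := by omega
          have hi' : (i : ℝ) = k - 1 := by rw [← h3]; push_cast; ring
          rcases le_or_gt (k * η) Real.pi with hle | hgt
          · refine f₂_cross_nonpos hc (γ := ((i : ℝ) + 1) * η - 2 * Real.pi) (hd' _ rfl)
              (hx.cone_z h (j := 0) (by omega) ?_ ?_) ?_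
            · rw [hi']; push_cast; linarith [h.lower]
            · rw [hi']; push_cast; linarith
            · rw [f₂_z hc]
              refine h.w_zero_right_z ?_
              have := h.w_zero_bound' hle
              rwa [h3]
          · refine f₂_cross_nonpos hc (γ := ((i : ℝ) + 1) * η - 2 * Real.pi) (hd' _ rfl)
              (hx.cone_z h (j := 1) (by omega) ?_ ?_) ?_
            · rw [hi']; push_cast; linarith
            · rw [hi']; push_cast; linarith
            · rw [f₂_z hc]
              exact (h.inside_w (m := 0) (by omega)).right_z (i + 1) hi
  · obtain ⟨ρ, -, he⟩ := h.edge
    rw [← cross_sub_eq_of_edge he]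
    refine f₂_cross_nonpos hc (γ := -Real.pi + (η - θ)) ?_
      (hx.cone_z h (j := 1) (by omega) ?_ ?_) ?_
    · rw [← dir_add_two_pi]; congr 1; ring
    · push_cast; linarith
    · push_cast; linarith
    · rw [f₂_z hc, sub_self]; simp [cross]
  · refine f₂_cross_nonpos hc ?_ (hx.right_z' h (j := m + 1) hm) ?_
    · rw [← dir_add_two_pi]; congr 1; push_cast; ring
    · rw [f₂_z hc, sub_self]; simp [cross]
  -- The last edge is the f₂-image of the long one, so its half-plane pulls back to that of the long
  -- edge.
  · refine f₂_cross_nonpos hc ?_ hx.right_long ?_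
    · rw [← dir_add_two_pi]; congr 1; ring
    · rw [f₂_z hc, sub_self]; simp [cross]

/-! ### Comparison with the attractor -/

lemma isClosed_inside : IsClosed {x | Inside k η θ x} := by
  have hcl : ∀ t p, IsClosed {x : ℂ | cross (dir t) (x - p) ≤ 0} := fun t p => by
    refine isClosed_le ?_ continuous_const
    unfold cross
    fun_prop
  have : {x | Inside k η θ x} =
      (⋂ i ∈ Set.Iic k, {x | cross (dir (-Real.pi + ((i : ℝ) - 1) * η)) (x - z η i) ≤ 0}) ∩
      {x | cross (dir (-θ)) (x - z η k) ≤ 0} ∩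
      (⋂ m ∈ {m | m + 1 < k}, {x | cross (dir (m * η)) (x - w η (m + 1)) ≤ 0}) ∩
      {x | cross (dir (Real.pi - η - θ)) (x - w η k) ≤ 0} := by
    ext x
    simp only [Set.mem_ofPred_eq, Set.mem_inter_iff, Set.mem_iInter, Set.mem_Iic]
    exact ⟨fun h => ⟨⟨⟨h.right_z, h.right_long⟩, h.right_w⟩, h.right_last⟩,
      fun h => ⟨h.1.1.1, h.1.1.2, h.1.2, h.2⟩⟩
  rw [this]
  exact (((isClosed_biInter fun i _ => hcl _ _).inter (hcl _ _)).inter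
    (isClosed_biInter fun m _ => hcl _ _)).inter (hcl _ _)

lemma vertex_mem (h : Inclination k η θ) {K : Set ℂ} (hK : IsAttractor η K) (i : ℕ) :
    vertex k η i ∈ K := by
  have hc := h.cos_pos
  have hz0 : z η 0 ∈ K := by
    refine mem_of_fixed hK.isCompact hK.nonempty (g := fun x => f₂ η (f₂ η (f₁ η (f₁ η x))))
      (q := ‖a η‖ ^ 4) (by linarith [h.one_sub_pos])
      (fun x hx => hK.f₂_mem (hK.f₂_mem (hK.f₁_mem (hK.f₁_mem hx)))) (fun x y => ?_) ?_
    · rw [dist_f₂, dist_f₂, dist_f₁, dist_f₁]; ring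
    · simp only [f₁_z, f₂_z hc]
      exact h.f₂_w_two
  have hz : ∀ j, z η j ∈ K := fun j => by
    induction j with
    | zero => exact hz0
    | succ j ih => rw [← f₁_z]; exact hK.f₁_mem ih
  have hw : ∀ j, w η j ∈ K := fun j => by rw [← f₂_z hc]; exact hK.f₂_mem (hz j)
  have hb : b₀ η ∈ K := by rw [← f₂_w_one hc]; exact hK.f₂_mem (hw 1)
  unfold vertex
  split_ifs
  · exact hb
  · exact hz _
  · exact hw _
  · exact hb

/-- The convex hull of the attractor is the polygon with the given vertices. -/
theorem convexHull_eq (h : Inclination k η θ) {K : Set ℂ} (hK : IsAttractor η K) :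
    convexHull ℝ K = convexHull ℝ (vertex k η '' Set.Iio (2 * k + 2)) := by
  refine Set.Subset.antisymm (convexHull_min ?_ (convex_convexHull ℝ _)) (convexHull_mono ?_)
  · have hsub : K ⊆ {x | Inside k η θ x} :=
      hK.subset_of_mapsTo h.norm_lt_one ⟨z η 0, h.inside_z (Nat.zero_le k)⟩ isClosed_inside
        (fun _ hx => h.f₁_inside hx) (fun _ hx => h.f₂_inside hx)
    intro x hx
    exact h.clockwisePolygon.mem_convexHull fun i hi => h.cross_nonpos_of_inside (hsub hx) hi
  · rintro _ ⟨i, -, rfl⟩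
    exact h.vertex_mem hK i

end Inclination

end DragonCurve

theorem theorem1p3 :
    (∀ k : ℕ, 4 ≤ k → ∃! t : ℝ, DragonCurve.IsPhiZero k t) ∧
    (∀ η ∈ Set.Ioo (0 : ℝ) (Real.pi / 3), ∃! K : Set ℂ, DragonCurve.IsAttractor η K) ∧
    ∀ k : ℕ, 4 ≤ k → ∀ ηk ηk1 : ℝ,
      DragonCurve.IsPhiZero k ηk → DragonCurve.IsPhiZero (k + 1) ηk1 →
      ∀ η ∈ Set.Ico ηk1 ηk, ∀ K : Set ℂ, DragonCurve.IsAttractor η K →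
        DragonCurve.IsPolygonWithClockwiseVertices (convexHull ℝ K)
          (DragonCurve.vertexList η k) := by
  refine ⟨fun k hk => DragonCurve.existsUnique_isPhiZero hk, fun η hη => ?_, ?_⟩
  · have ha := DragonCurve.norm_a_lt_one hη.1 hη.2
    obtain ⟨K, hK⟩ := DragonCurve.exists_isAttractor ha
    exact ⟨K, hK, fun K' hK' => hK'.eq ha hK⟩
  · intro k hk ηk ηk1 h₁ h₂ η hη K hK
    obtain ⟨θ, hθ⟩ := (DragonCurve.admissible_of_mem hk h₁ h₂ hη).exists_inclination
    rw [hθ.convexHull_eq hK]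
    exact hθ.clockwisePolygon.isPolygonWithClockwiseVertices DragonCurve.length_vertexList
      DragonCurve.getElem_vertexList
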